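/- **Setting.** An instance consists of a finite directed graph $G=(V,E)$ (parallel edges allowed) with a source $s$ and a sink $t\neq s$, a demand $d>0$, and for every edge $e$ a mean latency function $\ell_e\ge 0$ (continuous, non-decreasing) and a variance function $v_e\ge 0$ (continuous) of the flow $f_e\ge 0$ on $e$. A flow is a vector $(f_p)_p\ge 0$ over the simple directed $s$-$t$ paths with $\sum_p f_p=d$; $f_e=\sum_{p\ni e}f_p$, $\ell_p(f)=\sum_{e\in p}\ell_e(f_e)$, $v_p(f)=\sum_{e\in p}v_e(f_e)$, and the social cost is $C(f)=\sum_p f_p\,\ell_p(f)$. A $\gamma$-equilibrium is a flow $f$ such that $\ell_p(f)+\gamma v_p(f)\le \ell_q(f)+\gamma v_q(f)$ for all paths $p,q$ with $f_p>0$. A RAWE is a $\gamma$-equilibrium; a RNWE is a $0$-equilibrium. For a family $\mathcal F$ of instances, the price of risk aversion $\mathrm{PRA}(\mathcal F,\gamma,\kappa)$ is the supremum of $C(x)/C(z)$ over the instances in $\mathcal F$ and their RAWE $x$ and RNWE $z$ such that $v_e(x_e)\le\kappa\,\ell_e(x_e)$ for all $e$. Given $x$ and $z$, delete the edges that neither flow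 uses and let $A=\{e: x_e<z_e\}$ and $B=\{e: z_e\le x_e\}$ among the remaining edges. An alternating path is a vertex-simple $s$-$t$ path that traverses edges of $A$ in their direction and edges of $B$ against their direction; its maximal blocks of consecutive forward edges are its disjoint forward subpaths. **Construction.** $G^1$ is the Braess graph with vertices $s,a,b,t$ and edges $s\to a$, $a\to t$, $s\to b$, $b\to t$ and the vertical edge $a\to b$. For $i\ge2$, $G^i$ is the Braess graph with $a\to t$ and $s\to b$ each replaced by a copy of $G^{i-1}$. In $G^i$, the edges $s\to a$ and $b\to t$ introduced at level $j$ have mean latency function $a_j(\cdot)$ and variance $0$, all vertical edges have mean latency $1$ and variance $0$, and the remaining edges have mean latency $1$ and variance $\kappa$. **Theorem.** Let $\gamma,\kappa\ge 0$. 1. For all $i\ge1$ and $d>0$, the graph $G^i$ has $2^{i+1}$ vertices, and there are continuous, non-decreasing, non-negative functions $a_1,\dots,a_i$ such that for the instance on $G^i$ with demand $d$: every RNWE $z$ has $C(z)=d$; every RAWE $x$ satisfies $v_e(x_e)\le\kappa\ell_e(x_e)$ for all $e$ and $C(x)=(1+2^i\gamma\kappa)\,d$; and there are a RAWE $x$ and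 a RNWE $z$ which together use all edges and for which there is exactly one alternating path, and this path has exactly $\eta=2^i$ disjoint forward subpaths. 2. For $\eta\ge1$ let $\mathcal F_\eta$ be the family of instances (with their equilibria $x,z$) that admit an alternating path with at most $\eta$ disjoint forward subpaths. With $UB=1+\eta\gamma\kappa$ and $LB=1+2^{\lfloor\log_2\eta\rfloor}\gamma\kappa$, the ratio $LB$ is attained by an instance in $\mathcal F_\eta$, $\mathrm{PRA}(\mathcal F_\eta,\gamma,\kappa)\le UB$, and $UB/LB<2$. If $\eta$ is a power of $2$, then $LB=UB$ and $\mathrm{PRA}(\mathcal F_\eta,\gamma,\kappa)=1+\eta\gamma\kappa$, so the supremum is attained. 3. For $n\ge2$ let $\mathcal G_n$ be the family of instances on graphs with at most $n$ vertices. With $UB=1+\gamma\kappa\lceil (n-1)/2\rceil$ and $LB=1+\gamma\kappa\,2^{\lfloor\log_2 n\rfloor}/2$, the ratio $LB$ is attained by an instance in $\mathcal G_n$, $\mathrm{PRA}(\mathcal G_n,\gamma,\kappa)\le UB$, and $UB/LB<2$. If $n$ is a power of $2$, then $LB=UB$ and $\mathrm{PRA}(\mathcal G_n,\gamma,\kappa)=1+\gamma\kappa\lceil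 (n-1)/2\rceil$, so the supremum is attained. -/

import Mathlib

open scoped ENNReal

noncomputable section

namespace RiskRouting

/-! ### Walks and simple paths

Steps of a walk are elements of a type `σ`; `src` and `tgt` give the two ends of a step. -/

section Walks

variable {σ V : Type}

/-- The list of steps `p` is a walk from `u` to `w`. -/
def IsWalk (src tgt : σ → V) : V → List σ → V → Prop
  | u, [], w => u = w
  | u, e :: p, w => src e = u ∧ IsWalk src tgt (tgt e) p w

/-- The list of steps `p` is a path from `u` to `w`: a walk that visits no vertex twice. -/
def IsSimplePath (src tgt : σ → V) (u : V) (p : List σ) (w : V) : Prop :=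
  IsWalk src tgt u p w ∧ (u :: p.map tgt).Nodup

end Walks

/-! ### Networks and instances of the routing game -/

/-- A finite directed (multi)graph with a source `s` and a sink `t`. -/
structure Network where
  V : Type
  E : Type
  [fintypeV : Fintype V]
  [decEqV : DecidableEq V]
  [fintypeE : Fintype E]
  [decEqE : DecidableEq E]
  src : E → V
  tgt : E → V
  s : V
  t : V
  s_ne_t : s ≠ t

attribute [instance] Network.fintypeV Network.decEqV Network.fintypeE Network.decEqE

/-- The set of feasible paths: the directed simple paths from `s` to `t`, as lists of edges. -/
def Network.Path (N : Network) : Type :=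
  {p : List N.E // IsSimplePath N.src N.tgt N.s p N.t}

instance Network.finitePath (N : Network) : Finite N.Path := by
  have h : ∀ p : N.Path, p.1.Nodup := fun p =>
    List.Nodup.of_map N.tgt (List.nodup_cons.mp p.2.2).2
  exact Finite.of_injective
    (fun p : N.Path => (⟨p.1, h p⟩ : {l : List N.E // l.Nodup}))
    (fun p q hpq => Subtype.ext (congrArg (fun l => l.1) hpq))

instance Network.fintypePath (N : Network) : Fintype N.Path := Fintype.ofFinite _

/-- Mean latency functions: continuous, non-decreasing and non-negative functions of a
non-negative flow. -/
structure IsLatency (f : ℝ → ℝ) : Prop where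
  continuousOn : ContinuousOn f (Set.Ici 0)
  monotoneOn : MonotoneOn f (Set.Ici 0)
  nonneg : ∀ y, 0 ≤ y → 0 ≤ f y

/-- Variance functions: continuous and non-negative functions of a non-negative flow. -/
structure IsVariance (f : ℝ → ℝ) : Prop where
  continuousOn : ContinuousOn f (Set.Ici 0)
  nonneg : ∀ y, 0 ≤ y → 0 ≤ f y

/-- An instance `(G, d, ℓ, v)`: a network, a positive demand, and on every edge the mean and
the variance of the travel time as functions of the flow on that edge. -/
structure Game extends Network where
  demand : ℝ
  demand_pos : 0 < demand
  lat : E → ℝ → ℝ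
  var : E → ℝ → ℝ
  isLatency_lat : ∀ e, IsLatency (lat e)
  isVariance_var : ∀ e, IsVariance (var e)

namespace Game

variable (I : Game)

/-- The set of feasible paths of the instance. -/
abbrev Path : Type := I.toNetwork.Path

/-- A path flow is feasible if it is non-negative and routes the whole demand. -/
def IsFeasible (f : I.Path → ℝ) : Prop :=
  (∀ p, 0 ≤ f p) ∧ ∑ p, f p = I.demand

/-- The flow `f_e = ∑_{p ∋ e} f_p` on the edge `e`. -/
def edgeFlow (f : I.Path → ℝ) (e : I.E) : ℝ :=
  ∑ p : I.Path, if e ∈ p.1 then f p else 0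

/-- The expected latency `ℓ_p(f) = ∑_{e ∈ p} ℓ_e(f_e)` of a path. -/
def pathLatency (f : I.Path → ℝ) (p : I.Path) : ℝ :=
  (p.1.map fun e => I.lat e (I.edgeFlow f e)).sum

/-- The variance `v_p(f) = ∑_{e ∈ p} v_e(f_e)` of a path. -/
def pathVariance (f : I.Path → ℝ) (p : I.Path) : ℝ :=
  (p.1.map fun e => I.var e (I.edgeFlow f e)).sum

/-- The mean-variance objective `ℓ_p(f) + γ v_p(f)`. -/
def pathCost (γ : ℝ) (f : I.Path → ℝ) (p : I.Path) : ℝ :=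
  I.pathLatency f p + γ * I.pathVariance f p

/-- `γ`-equilibrium: a feasible flow such that each path with positive flow has minimum path
cost. For the given risk-aversion coefficient `γ` this is a RAWE, and for `γ = 0` a RNWE. -/
def IsEquilibrium (γ : ℝ) (f : I.Path → ℝ) : Prop :=
  I.IsFeasible f ∧ ∀ p, 0 < f p → ∀ q, I.pathCost γ f p ≤ I.pathCost γ f q

/-- The social cost `C(f) = ∑_p f_p ℓ_p(f)`. -/
def socialCost (f : I.Path → ℝ) : ℝ := ∑ p, f p * I.pathLatency f p

/-- On every edge, the variance at the flow `x` is at most `κ` times the expected latency. -/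
def VarianceBounded (κ : ℝ) (x : I.Path → ℝ) : Prop :=
  ∀ e, I.var e (I.edgeFlow x e) ≤ κ * I.lat e (I.edgeFlow x e)

/-! ### Alternating paths -/

/-- The vertex at which the step `(e, b)` starts: `e` is traversed along its direction if
`b = true` and against it if `b = false`. -/
def stepSrc (a : I.E × Bool) : I.V := if a.2 then I.src a.1 else I.tgt a.1

/-- The vertex at which the step `(e, b)` ends. -/
def stepTgt (a : I.E × Bool) : I.V := if a.2 then I.tgt a.1 else I.src a.1

/-- The edges of `A`: those with `x_e < z_e`. -/
def InA (x z : I.Path → ℝ) (e : I.E) : Prop := I.edgeFlow x e < I.edgeFlow z e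

/-- The edges of `B`: those with `z_e ≤ x_e`. -/
def InB (x z : I.Path → ℝ) (e : I.E) : Prop := I.edgeFlow z e ≤ I.edgeFlow x e

/-- The edge is used by one of the two flows. -/
def Used (x z : I.Path → ℝ) (e : I.E) : Prop := 0 < I.edgeFlow x e ∨ 0 < I.edgeFlow z e

/-- `π` is an alternating path for the flows `x` and `z`: a path from `s` to `t`, visiting no
vertex twice, whose forward edges are in `A` and whose backward edges are in `B`. Edges that
neither flow uses count as deleted from the graph. -/
def IsAlternatingPath (x z : I.Path → ℝ) (π : List (I.E × Bool)) : Prop :=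
  IsSimplePath I.stepSrc I.stepTgt I.s π I.t ∧
    ∀ a ∈ π, I.Used x z a.1 ∧ if a.2 then I.InA x z a.1 else I.InB x z a.1

end Game

/-- Number of maximal blocks of consecutive forward steps in `π`, not counting a block that
continues a preceding forward step (present iff `prev = true`). -/
def forwardBlocksFrom {E : Type} : Bool → List (E × Bool) → ℕ
  | _, [] => 0
  | prev, a :: π => (if a.2 && !prev then 1 else 0) + forwardBlocksFrom a.2 π

/-- The number of disjoint forward subpaths `A₁, A₂, …` of `π = A₁-B₁-A₂-B₂-⋯`. -/
def numForwardSubpaths {E : Type} (π : List (E × Bool)) : ℕ := forwardBlocksFrom false π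

/-! ### The price of risk aversion -/

/-- A family of instances. Membership may refer to the two equilibria that are compared. -/
abbrev Family : Type 1 := (I : Game) → (x z : I.Path → ℝ) → Prop

/-- The ratios `C(x) / C(z)`, with `x` a RAWE and `z` a RNWE of an instance in the family such
that `v(x) ≤ κ ℓ(x)`. A positive cost divided by zero is `∞`. -/
def riskRatios (F : Family) (γ κ : ℝ) : Set ℝ≥0∞ :=
  {ρ | ∃ (I : Game) (x z : I.Path → ℝ), F I x z ∧
    I.IsEquilibrium γ x ∧ I.IsEquilibrium 0 z ∧ I.VarianceBounded κ x ∧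
    ρ = ENNReal.ofReal (I.socialCost x) / ENNReal.ofReal (I.socialCost z)}

/-- The price of risk aversion of a family of instances. -/
def priceOfRiskAversion (F : Family) (γ κ : ℝ) : ℝ≥0∞ := sSup (riskRatios F γ κ)

/-- Instances admitting an alternating path with at most `η` disjoint forward subpaths. -/
def alternatingFamily (η : ℕ) : Family := fun I x z =>
  ∃ π, I.IsAlternatingPath x z π ∧ numForwardSubpaths π ≤ η

/-- Instances on graphs with at most `n` vertices. -/
def vertexFamily (n : ℕ) : Family := fun I _ _ => Fintype.card I.V ≤ n

/-- The upper bound `1 + η γ κ` for alternating paths with up to `η` forward subpaths. -/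
def alternatingUB (γ κ : ℝ) (η : ℕ) : ℝ := 1 + η * γ * κ

/-- The upper bound `1 + γ κ ⌈(n - 1) / 2⌉` for graphs with up to `n` vertices. -/
def vertexUB (γ κ : ℝ) (n : ℕ) : ℝ := 1 + γ * κ * (⌈((n : ℝ) - 1) / 2⌉ : ℝ)

/-- The lower bound `1 + m γ κ`, where `m` is the largest power of two with `m ≤ η`. -/
def alternatingLB (γ κ : ℝ) (η : ℕ) : ℝ := 1 + (2 : ℝ) ^ Nat.log 2 η * γ * κ

/-- The lower bound `1 + γ κ m / 2`, where `m` is the largest power of two with `m ≤ n`. -/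
def vertexLB (γ κ : ℝ) (n : ℕ) : ℝ := 1 + γ * κ * ((2 : ℝ) ^ Nat.log 2 n / 2)

/-! ### The recursive Braess construction -/

/-- Types of edges of the construction: an edge of the innermost copies, a vertical edge, or
one of the two edges of level `j` that carry the latency function `a_j`. -/
inductive EdgeKind : Type
  | base
  | vertical
  | link (j : ℕ)

/-- A network with a type assigned to each edge. -/
structure KindNetwork extends Network where
  kind : E → EdgeKind

/-- The graph with two vertices and a single edge from `s` to `t`. -/
def singleEdge : KindNetwork where
  V := Fin 2
  E := Unit
  src := fun _ => 0
  tgt := fun _ => 1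
  s := 0
  t := 1
  s_ne_t := by decide
  kind := fun _ => EdgeKind.base

/-- The Braess graph with the upper-right and the lower-left edges replaced by copies of `N`.
The upper copy is `Sum.inl`, the lower copy is `Sum.inr`; the source is the source of the lower
copy and the sink is the sink of the upper copy. The three further edges are: `0`, the
upper-left edge from the source to the source of the upper copy; `1`, the vertical edge from
the source of the upper copy to the sink of the lower copy; `2`, the lower-right edge from the
sink of the lower copy to the sink. -/
def braessStep (j : ℕ) (N : KindNetwork) : KindNetwork where
  V := N.V ⊕ N.V
  E := (N.E ⊕ N.E) ⊕ Fin 3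
  src := Sum.elim (Sum.elim (fun e => Sum.inl (N.src e)) (fun e => Sum.inr (N.src e)))
    ![Sum.inr N.s, Sum.inl N.s, Sum.inr N.t]
  tgt := Sum.elim (Sum.elim (fun e => Sum.inl (N.tgt e)) (fun e => Sum.inr (N.tgt e)))
    ![Sum.inl N.s, Sum.inr N.t, Sum.inl N.t]
  s := Sum.inr N.s
  t := Sum.inl N.t
  s_ne_t := Sum.inr_ne_inl
  kind := Sum.elim (Sum.elim N.kind N.kind)
    ![EdgeKind.link j, EdgeKind.vertical, EdgeKind.link j]

/-- The graph `Gⁱ`: `G¹` is the Braess graph, and `Gⁱ` is the Braess graph with the upper-right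
and lower-left edges replaced by copies of `Gⁱ⁻¹`. -/
def recursiveBraess : ℕ → KindNetwork
  | 0 => singleEdge
  | i + 1 => braessStep (i + 1) (recursiveBraess i)

/-- Mean latencies: `1` on base edges and vertical edges, `a_j` on the level-`j` edges. -/
def kindLatency (a : ℕ → ℝ → ℝ) : EdgeKind → ℝ → ℝ
  | .base => fun _ => 1
  | .vertical => fun _ => 1
  | .link j => a j

/-- Variances: `κ` on base edges and `0` elsewhere. -/
def kindVariance (κ : ℝ) : EdgeKind → ℝ → ℝ
  | .base => fun _ => κ
  | .vertical => fun _ => 0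
  | .link _ => fun _ => 0

theorem isLatency_kindLatency {a : ℕ → ℝ → ℝ} (ha : ∀ j, IsLatency (a j)) (k : EdgeKind) :
    IsLatency (kindLatency a k) := by
  cases k with
  | base => exact ⟨continuousOn_const, monotoneOn_const, fun _ _ => zero_le_one⟩
  | vertical => exact ⟨continuousOn_const, monotoneOn_const, fun _ _ => zero_le_one⟩
  | link j => exact ha j

theorem isVariance_kindVariance {κ : ℝ} (hκ : 0 ≤ κ) (k : EdgeKind) :
    IsVariance (kindVariance κ k) := by
  cases k with
  | base => exact ⟨continuousOn_const, fun _ _ => hκ⟩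
  | vertical => exact ⟨continuousOn_const, fun _ _ => le_rfl⟩
  | link j => exact ⟨continuousOn_const, fun _ _ => le_rfl⟩

/-- The instance on `Gⁱ` with demand `d` and latency functions `a_1, …, a_i`. -/
def recursiveGame (i : ℕ) {d κ : ℝ} (hd : 0 < d) (hκ : 0 ≤ κ)
    (a : ℕ → ℝ → ℝ) (ha : ∀ j, IsLatency (a j)) : Game where
  toNetwork := (recursiveBraess i).toNetwork
  demand := d
  demand_pos := hd
  lat := fun e => kindLatency a ((recursiveBraess i).kind e)
  var := fun e => kindVariance κ ((recursiveBraess i).kind e)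
  isLatency_lat := fun e => isLatency_kindLatency ha ((recursiveBraess i).kind e)
  isVariance_var := fun e => isVariance_kindVariance hκ ((recursiveBraess i).kind e)

/-- The instance `I` is tight for `η`: both kinds of equilibria exist and satisfy
`C(z) = d` and `C(x) = (1 + η γ κ) d`; moreover, for some pair of equilibria, all edges are
used and there is exactly one alternating path, which has exactly `η` disjoint forward
subpaths. -/
structure IsTightInstance (γ κ : ℝ) (η : ℕ) (I : Game) : Prop where
  cost_neutral : ∀ z, I.IsEquilibrium 0 z → I.socialCost z = I.demand
  cost_averse : ∀ x, I.IsEquilibrium γ x →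
    I.VarianceBounded κ x ∧ I.socialCost x = (1 + η * γ * κ) * I.demand
  alternating : ∃ x z, I.IsEquilibrium γ x ∧ I.IsEquilibrium 0 z ∧ (∀ e, I.Used x z e) ∧
    ∃ π, I.IsAlternatingPath x z π ∧ numForwardSubpaths π = η ∧
      ∀ π', I.IsAlternatingPath x z π' → π' = π

end RiskRouting

end

/-!
Upper bound. Let `φ` and `ψ` be the distances from the source with respect to the edge costs of the
risk-averse equilibrium `x` and of the risk-neutral equilibrium `z`. Edges in use are tight for the
distance of the equilibrium that uses them. Hence, along an alternating path, a backward step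
increases `φ` by at most the increase of `ψ`, and a forward step by at most `1 + γ κ` times the
increase of `ψ`. Since `ψ` increases by at most `ψ t` along a block of forward steps, the sum over
the path is `φ t ≤ (1 + η γ κ) ψ t` (`Game.potential_sub_le`, `Game.socialCost_le_of_weakSteps`).
For this argument, forward steps along edges with `x_e = z_e > 0` are harmless, and once they are
allowed a cut argument shows that an alternating path always exists
(`Game.exists_weak_alternating_path`). It has at most `n / 2` forward subpaths on `n` vertices.

Lower bound. On `Gⁱ`, let every base edge carry `b` and every vertical edge `v`; then the links of
level `j` carry `2 ^ (j - 1) (b + v)`. The risk-neutral equilibrium has `v = 0`, the risk-averse one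
`b = 0`, and the latter puts more flow on every link, so that the link latencies can vanish at the
former and equal `2 ^ (j - 1) γ κ` at the latter. In both cases the edge costs are potential
differences (`exists_potential_kindCost`), so that all paths cost the same. The edge costs of an
equilibrium are unique (`Game.IsEquilibrium.edgeCost_eq`), which carries the result over to all
equilibria (`IsRecursiveLike.isTightInstance`). The only alternating path visits all vertices: every
other admissible step leads back to a vertex visited before
(`KindNetwork.IsPosition.simplePath_unique`). The ratio `1 + γ κ` is attained on two parallel edges.
-/

namespace RiskRouting

/-! ### Walks -/

section Walks

variable {σ V : Type} {src tgt : σ → V}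

theorem isWalk_append {p q : List σ} {u w : V} :
    IsWalk src tgt u (p ++ q) w ↔ ∃ v, IsWalk src tgt u p v ∧ IsWalk src tgt v q w := by
  induction p generalizing u with
  | nil => simp [IsWalk]
  | cons e p ih => simp [IsWalk, ih, and_assoc]

theorem IsWalk.append {p q : List σ} {u v w : V} (hp : IsWalk src tgt u p v)
    (hq : IsWalk src tgt v q w) : IsWalk src tgt u (p ++ q) w :=
  isWalk_append.2 ⟨v, hp, hq⟩

theorem IsWalk.map {σ' V' : Type} {src' tgt' : σ' → V'} (f : σ → σ') (g : V → V')
    (hs : ∀ e, src' (f e) = g (src e)) (ht : ∀ e, tgt' (f e) = g (tgt e))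
    {p : List σ} {u w : V} (hp : IsWalk src tgt u p w) :
    IsWalk src' tgt' (g u) (p.map f) (g w) := by
  induction p generalizing u with
  | nil => exact congrArg g hp
  | cons e p ih => exact ⟨(hs e).trans (congrArg g hp.1), ht e ▸ ih hp.2⟩

/-- If every weight is a potential difference, the weight of a walk depends on its ends only. -/
theorem IsWalk.sum_eq_potential_sub {φ : V → ℝ} {c : σ → ℝ}
    (hc : ∀ e, c e = φ (tgt e) - φ (src e)) {p : List σ} {u w : V}
    (hp : IsWalk src tgt u p w) : (p.map c).sum = φ w - φ u := by
  induction p generalizing u with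
  | nil => simp [show u = w from hp]
  | cons e p ih =>
    rw [List.map_cons, List.sum_cons, ih hp.2, hc, hp.1]
    ring

theorem IsSimplePath.exists_sublist_from {q : List σ} {u v w : V}
    (hq : IsSimplePath src tgt u q w) (hv : v ∈ u :: q.map tgt) :
    ∃ r, r.Sublist q ∧ IsSimplePath src tgt v r w := by
  induction q generalizing u with
  | nil =>
    obtain rfl : v = u := by simpa using hv
    exact ⟨[], List.Sublist.refl _, hq⟩
  | cons e q ih =>
    rcases List.mem_cons.1 hv with rfl | hv
    · exact ⟨e :: q, List.Sublist.refl _, hq⟩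
    · obtain ⟨r, hr, hr'⟩ := ih ⟨hq.1.2, (List.nodup_cons.1 hq.2).2⟩ hv
      exact ⟨r, hr.cons e, hr'⟩

/-- Cutting out cycles turns a walk into a simple path that uses only steps of the walk. -/
theorem IsWalk.exists_isSimplePath {p : List σ} {u w : V} (hp : IsWalk src tgt u p w) :
    ∃ q, q.Sublist p ∧ IsSimplePath src tgt u q w := by
  induction p generalizing u with
  | nil => exact ⟨[], List.Sublist.refl _, hp, by simp⟩
  | cons e p ih =>
    obtain ⟨q, hqp, hq⟩ := ih hp.2
    by_cases hu : u ∈ tgt e :: q.map tgt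
    · obtain ⟨r, hr, hr'⟩ := hq.exists_sublist_from hu
      exact ⟨r, (hr.trans hqp).cons e, hr'⟩
    · exact ⟨e :: q, hqp.cons_cons e, ⟨hp.1, hq.1⟩, List.nodup_cons.2 ⟨hu, hq.2⟩⟩

end Walks

/-! ### Edge flows and equilibria -/

theorem Network.Path.nodup {N : Network} (p : N.Path) : p.1.Nodup :=
  List.Nodup.of_map N.tgt (List.nodup_cons.mp p.2.2).2

namespace Game

variable {I : Game}

theorem sum_mul_pathSum (f : I.Path → ℝ) (c : I.E → ℝ) :
    ∑ p, f p * (p.1.map c).sum = ∑ e, I.edgeFlow f e * c e := by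
  have h (p : I.Path) : (p.1.map c).sum = ∑ e, if e ∈ p.1 then c e else 0 := by
    rw [← List.sum_toFinset c p.nodup, ← Finset.sum_filter]
    congr 1
    ext e
    simp
  simp only [h, edgeFlow, Finset.mul_sum, Finset.sum_mul]
  rw [Finset.sum_comm]
  refine Finset.sum_congr rfl fun e _ => Finset.sum_congr rfl fun p _ => ?_
  split_ifs <;> simp

theorem sum_edgeFlow_mul_potential {f : I.Path → ℝ} (hf : I.IsFeasible f) (φ : I.V → ℝ) :
    ∑ e, I.edgeFlow f e * (φ (I.tgt e) - φ (I.src e)) = I.demand * (φ I.t - φ I.s) := by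
  rw [← sum_mul_pathSum, ← hf.2, Finset.sum_mul]
  refine Finset.sum_congr rfl fun p _ => ?_
  rw [p.2.1.sum_eq_potential_sub (φ := φ) fun e => rfl]

theorem edgeFlow_nonneg {f : I.Path → ℝ} (hf : I.IsFeasible f) (e : I.E) :
    0 ≤ I.edgeFlow f e :=
  Finset.sum_nonneg fun p _ => by
    split_ifs
    exacts [hf.1 p, le_rfl]

theorem exists_path_of_edgeFlow_pos {f : I.Path → ℝ} {e : I.E} (h : 0 < I.edgeFlow f e) :
    ∃ p : I.Path, e ∈ p.1 ∧ 0 < f p := by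
  by_contra! hn
  refine h.not_ge (Finset.sum_nonpos fun p _ => ?_)
  split_ifs with hp
  exacts [hn p hp, le_rfl]

theorem exists_path_pos {f : I.Path → ℝ} (hf : I.IsFeasible f) : ∃ p, 0 < f p := by
  by_contra! hn
  exact I.demand_pos.not_ge (hf.2 ▸ Finset.sum_nonpos fun p _ => hn p)

/-- The mean-variance objective `ℓ_e(f_e) + γ v_e(f_e)` of an edge. -/
noncomputable def edgeCost (I : Game) (γ : ℝ) (f : I.Path → ℝ) (e : I.E) : ℝ :=
  I.lat e (I.edgeFlow f e) + γ * I.var e (I.edgeFlow f e)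

theorem pathCost_eq_sum (γ : ℝ) (f : I.Path → ℝ) (p : I.Path) :
    I.pathCost γ f p = (p.1.map (I.edgeCost γ f)).sum := by
  rw [show I.edgeCost γ f = fun e => I.lat e (I.edgeFlow f e) + γ * I.var e (I.edgeFlow f e)
    from rfl, List.sum_map_add, List.sum_map_mul_left]
  rfl

theorem socialCost_eq_sum (f : I.Path → ℝ) :
    I.socialCost f = ∑ e, I.edgeFlow f e * I.lat e (I.edgeFlow f e) :=
  sum_mul_pathSum f fun e => I.lat e (I.edgeFlow f e)

theorem edgeCost_nonneg {γ : ℝ} (hγ : 0 ≤ γ) {f : I.Path → ℝ} (hf : I.IsFeasible f)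
    (e : I.E) : 0 ≤ I.edgeCost γ f e :=
  add_nonneg ((I.isLatency_lat e).nonneg _ (edgeFlow_nonneg hf e))
    (mul_nonneg hγ ((I.isVariance_var e).nonneg _ (edgeFlow_nonneg hf e)))

theorem isEquilibrium_of_potential {γ : ℝ} {f : I.Path → ℝ} (hf : I.IsFeasible f)
    (φ : I.V → ℝ) (h : ∀ e, I.edgeCost γ f e = φ (I.tgt e) - φ (I.src e)) :
    I.IsEquilibrium γ f := by
  refine ⟨hf, fun p _ q => ?_⟩
  rw [pathCost_eq_sum, pathCost_eq_sum, p.2.1.sum_eq_potential_sub h,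
    q.2.1.sum_eq_potential_sub h]

theorem IsEquilibrium.sum_edgeFlow_mul_le {γ : ℝ} {f g : I.Path → ℝ}
    (hf : I.IsEquilibrium γ f) (hg : I.IsFeasible g) :
    ∑ e, I.edgeFlow f e * I.edgeCost γ f e ≤ ∑ e, I.edgeFlow g e * I.edgeCost γ f e := by
  obtain ⟨p₀, hp₀⟩ := exists_path_pos hf.1
  rw [← sum_mul_pathSum, ← sum_mul_pathSum]
  simp only [← pathCost_eq_sum]
  calc ∑ p, f p * I.pathCost γ f p = ∑ p, f p * I.pathCost γ f p₀ := by
        refine Finset.sum_congr rfl fun p _ => ?_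
        rcases (hf.1.1 p).eq_or_lt with h | h
        · simp [← h]
        · rw [(hf.2 p h p₀).antisymm (hf.2 p₀ hp₀ p)]
    _ = ∑ p, g p * I.pathCost γ f p₀ := by
        rw [← Finset.sum_mul, ← Finset.sum_mul, hf.1.2, hg.2]
    _ ≤ ∑ p, g p * I.pathCost γ f p :=
        Finset.sum_le_sum fun p _ => mul_le_mul_of_nonneg_left (hf.2 p₀ hp₀ p) (hg.1 p)

/-- When the edge costs are non-decreasing, all equilibria induce the same edge costs: adding
the variational inequalities of two equilibria gives a sum of non-positive terms that is
non-negative. -/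
theorem IsEquilibrium.edgeCost_eq {γ : ℝ} {f g : I.Path → ℝ}
    (hmono : ∀ e, MonotoneOn (fun y => I.lat e y + γ * I.var e y) (Set.Ici 0))
    (hf : I.IsEquilibrium γ f) (hg : I.IsEquilibrium γ g) (e : I.E) :
    I.edgeCost γ f e = I.edgeCost γ g e := by
  have hterm (e : I.E) :
      (I.edgeFlow g e - I.edgeFlow f e) * (I.edgeCost γ f e - I.edgeCost γ g e) ≤ 0 := by
    have h0f := edgeFlow_nonneg hf.1 e
    have h0g := edgeFlow_nonneg hg.1 e
    rcases le_total (I.edgeFlow f e) (I.edgeFlow g e) with h | h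
    · exact mul_nonpos_of_nonneg_of_nonpos (sub_nonneg.2 h)
        (sub_nonpos.2 (hmono e h0f h0g h))
    · exact mul_nonpos_of_nonpos_of_nonneg (sub_nonpos.2 h)
        (sub_nonneg.2 (hmono e h0g h0f h))
  have hsum : 0 ≤ ∑ e, (I.edgeFlow g e - I.edgeFlow f e) *
      (I.edgeCost γ f e - I.edgeCost γ g e) := by
    have h1 := hf.sum_edgeFlow_mul_le hg.1
    have h2 := hg.sum_edgeFlow_mul_le hf.1
    simp only [sub_mul, mul_sub, Finset.sum_sub_distrib]
    linarith
  have hzero := (Finset.sum_eq_zero_iff_of_nonpos fun e _ => hterm e).1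
    (le_antisymm (Finset.sum_nonpos fun e _ => hterm e) hsum) e (Finset.mem_univ e)
  rcases mul_eq_zero.1 hzero with h | h
  · simp only [edgeCost, sub_eq_zero.1 h]
  · exact sub_eq_zero.1 h

/-! ### Shortest distances -/

/-- The infimum of the `c`-lengths of the walks from the source to `u`. Vertices that cannot be
reached from the source get the value `0`. -/
noncomputable def dist (I : Game) (c : I.E → ℝ) (u : I.V) : ℝ :=
  sInf {r | ∃ p, IsWalk I.src I.tgt I.s p u ∧ r = (p.map c).sum}

section Dist

variable {c : I.E → ℝ}

theorem sum_map_nonneg (hc : ∀ e, 0 ≤ c e) (p : List I.E) : 0 ≤ (p.map c).sum :=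
  List.sum_nonneg fun r hr => by
    obtain ⟨e, _, rfl⟩ := List.mem_map.1 hr
    exact hc e

theorem dist_nonneg (hc : ∀ e, 0 ≤ c e) (u : I.V) : 0 ≤ I.dist c u :=
  Real.sInf_nonneg fun _ ⟨p, _, hr⟩ => hr ▸ sum_map_nonneg hc p

theorem dist_le (hc : ∀ e, 0 ≤ c e) {u : I.V} {p : List I.E}
    (hp : IsWalk I.src I.tgt I.s p u) : I.dist c u ≤ (p.map c).sum :=
  csInf_le ⟨0, fun _ ⟨p, _, hr⟩ => hr ▸ sum_map_nonneg hc p⟩ ⟨p, hp, rfl⟩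

theorem dist_source (hc : ∀ e, 0 ≤ c e) : I.dist c I.s = 0 :=
  le_antisymm (dist_le hc (p := []) rfl) (dist_nonneg hc _)

theorem dist_tgt_le (hc : ∀ e, 0 ≤ c e) {e : I.E} {p : List I.E}
    (hp : IsWalk I.src I.tgt I.s p (I.src e)) :
    I.dist c (I.tgt e) ≤ I.dist c (I.src e) + c e := by
  rw [← sub_le_iff_le_add]
  refine le_csInf ⟨_, p, hp, rfl⟩ ?_
  rintro r ⟨q, hq, rfl⟩
  have := dist_le hc (hq.append (q := [e]) ⟨rfl, rfl⟩)
  simp only [List.map_append, List.sum_append, List.map_cons, List.map_nil, List.sum_cons,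
    List.sum_nil] at this
  linarith

/-- Initial pieces of shortest walks to the sink are shortest walks. -/
theorem dist_eq_of_append (hc : ∀ e, 0 ≤ c e) {u : I.V} {p q : List I.E}
    (hp : IsWalk I.src I.tgt I.s p u) (hq : IsWalk I.src I.tgt u q I.t)
    (hmin : ∀ r, IsWalk I.src I.tgt I.s r I.t → ((p ++ q).map c).sum ≤ (r.map c).sum) :
    I.dist c u = (p.map c).sum := by
  refine le_antisymm (dist_le hc hp) (le_csInf ⟨_, p, hp, rfl⟩ ?_)
  rintro _ ⟨r, hr, rfl⟩
  have := hmin _ (hr.append hq)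
  simpa using this

end Dist

section Equilibrium

variable {γ : ℝ} {f : I.Path → ℝ}

theorem IsEquilibrium.pathCost_le_walk (hγ : 0 ≤ γ) (hf : I.IsEquilibrium γ f) {p : I.Path}
    (hp : 0 < f p) {r : List I.E} (hr : IsWalk I.src I.tgt I.s r I.t) :
    (p.1.map (I.edgeCost γ f)).sum ≤ (r.map (I.edgeCost γ f)).sum := by
  obtain ⟨q, hqr, hq⟩ := hr.exists_isSimplePath
  have h := hf.2 p hp ⟨q, hq⟩
  rw [pathCost_eq_sum] at h
  refine h.trans ((pathCost_eq_sum γ f (⟨q, hq⟩ : I.Path)).trans_le ?_)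
  refine (hqr.map _).sum_le_sum fun a ha => ?_
  obtain ⟨e, _, rfl⟩ := List.mem_map.1 ha
  exact edgeCost_nonneg hγ hf.1 e

theorem IsEquilibrium.dist_sink (hγ : 0 ≤ γ) (hf : I.IsEquilibrium γ f) {p : I.Path}
    (hp : 0 < f p) : I.dist (I.edgeCost γ f) I.t = I.pathCost γ f p := by
  rw [pathCost_eq_sum]
  refine dist_eq_of_append (q := []) (edgeCost_nonneg hγ hf.1) p.2.1 rfl fun r hr => ?_
  simpa using hf.pathCost_le_walk hγ hp hr

/-- An edge that carries flow at equilibrium lies on a shortest path. -/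
theorem IsEquilibrium.dist_of_edgeFlow_pos (hγ : 0 ≤ γ) (hf : I.IsEquilibrium γ f) {e : I.E}
    (he : 0 < I.edgeFlow f e) :
    (∃ p, IsWalk I.src I.tgt I.s p (I.src e)) ∧
      I.dist (I.edgeCost γ f) (I.tgt e) =
        I.dist (I.edgeCost γ f) (I.src e) + I.edgeCost γ f e ∧
      I.dist (I.edgeCost γ f) (I.tgt e) ≤ I.dist (I.edgeCost γ f) I.t := by
  obtain ⟨p, hep, hp⟩ := exists_path_of_edgeFlow_pos he
  have hc := edgeCost_nonneg hγ hf.1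
  obtain ⟨q, r, hqr⟩ := List.append_of_mem hep
  have hw := p.2.1
  rw [hqr, isWalk_append] at hw
  obtain ⟨v, hq, rfl, hr⟩ := hw
  have hmin := fun l hl => hf.pathCost_le_walk hγ hp (r := l) hl
  rw [hqr] at hmin
  have h1 := dist_eq_of_append hc hq (q := e :: r) ⟨rfl, hr⟩ hmin
  have h2 := dist_eq_of_append hc (hq.append (q := [e]) ⟨rfl, rfl⟩) hr
    (by simpa using hmin)
  refine ⟨⟨q, hq⟩, by simp [h1, h2], ?_⟩
  rw [h2, hf.dist_sink hγ hp, pathCost_eq_sum, hqr]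
  have := sum_map_nonneg hc r
  simp only [List.map_append, List.sum_append, List.map_cons, List.map_nil, List.sum_cons,
    List.sum_nil]
  linarith

theorem IsEquilibrium.sum_mul_pathCost (hγ : 0 ≤ γ) (hf : I.IsEquilibrium γ f) :
    ∑ p, f p * I.pathCost γ f p = I.demand * I.dist (I.edgeCost γ f) I.t := by
  rw [← hf.1.2, Finset.sum_mul]
  refine Finset.sum_congr rfl fun p _ => ?_
  rcases (hf.1.1 p).eq_or_lt with h | h
  · simp [← h]
  · rw [hf.dist_sink hγ h]

theorem IsEquilibrium.socialCost_le (hγ : 0 ≤ γ) (hf : I.IsEquilibrium γ f) :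
    I.socialCost f ≤ I.demand * I.dist (I.edgeCost γ f) I.t := by
  rw [← hf.sum_mul_pathCost hγ]
  refine Finset.sum_le_sum fun p _ => mul_le_mul_of_nonneg_left ?_ (hf.1.1 p)
  refine le_add_of_nonneg_right (mul_nonneg hγ (sum_map_nonneg (fun e => ?_) p.1))
  exact (I.isVariance_var e).nonneg _ (edgeFlow_nonneg hf.1 e)

theorem IsEquilibrium.socialCost_eq (hf : I.IsEquilibrium 0 f) :
    I.socialCost f = I.demand * I.dist (I.edgeCost 0 f) I.t := by
  rw [← hf.sum_mul_pathCost le_rfl]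
  simp [socialCost, pathCost]

end Equilibrium

/-! ### The upper bound along an alternating path -/

/-- A step that an alternating path may take when ties are allowed in both directions: forward
along an edge that `z` uses and that carries at least as much of `z` as of `x`, or backward
along an edge that `x` uses and that carries at least as much of `x` as of `z`. -/
def WeakStep (I : Game) (x z : I.Path → ℝ) (a : I.E × Bool) : Prop :=
  if a.2 then I.edgeFlow x a.1 ≤ I.edgeFlow z a.1 ∧ 0 < I.edgeFlow z a.1
  else I.edgeFlow z a.1 ≤ I.edgeFlow x a.1 ∧ 0 < I.edgeFlow x a.1

theorem IsAlternatingPath.weakStep {x z : I.Path → ℝ} {π : List (I.E × Bool)}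
    (h : I.IsAlternatingPath x z π) {a : I.E × Bool} (ha : a ∈ π) : I.WeakStep x z a := by
  obtain ⟨hu, hs⟩ := h.2 a ha
  unfold WeakStep
  split_ifs with hb <;> simp only [hb] at hs
  · exact ⟨hs.le, hu.elim (fun h => h.trans hs) id⟩
  · exact ⟨hs, hu.elim id fun h => h.trans_le hs⟩

/-- If the increase of `φ` is at most that of `ψ` along backward steps, and at most `1 + K` times
that of `ψ` along forward steps, then the excess of `φ` over `ψ` is at most `K Ψ` per block of
forward steps, since `ψ` increases by at most `Ψ` along a block. A block that has already
started at a vertex `u` can only add `K (Ψ - ψ u)`. -/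
theorem potential_sub_le {φ ψ : I.V → ℝ} {K Ψ : ℝ} (hK : 0 ≤ K) (hψ : ∀ u, 0 ≤ ψ u)
    {π : List (I.E × Bool)}
    (hfwd : ∀ e, (e, true) ∈ π →
      φ (I.tgt e) - φ (I.src e) ≤ (1 + K) * (ψ (I.tgt e) - ψ (I.src e)) ∧ ψ (I.tgt e) ≤ Ψ)
    (hbwd : ∀ e, (e, false) ∈ π → φ (I.src e) - φ (I.tgt e) ≤ ψ (I.src e) - ψ (I.tgt e))
    (prev : Bool) {u w : I.V} (hu : prev = true → ψ u ≤ Ψ)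
    (hπ : IsWalk I.stepSrc I.stepTgt u π w) :
    φ w - φ u ≤ ψ w - ψ u +
      K * (Ψ * forwardBlocksFrom prev π + if prev then Ψ - ψ u else 0) := by
  induction π generalizing prev u with
  | nil =>
    obtain rfl : u = w := hπ
    have : 0 ≤ K * if prev then Ψ - ψ u else 0 := by
      refine mul_nonneg hK ?_
      split_ifs with hp
      exacts [sub_nonneg.2 (hu hp), le_rfl]
    simpa [forwardBlocksFrom] using this
  | cons a π ih =>
    obtain ⟨e, b⟩ := a
    obtain ⟨rfl, hπ⟩ := hπ
    have ih := @ih (fun e he => hfwd e (List.mem_cons_of_mem _ he))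
      (fun e he => hbwd e (List.mem_cons_of_mem _ he)) b (I.stepTgt (e, b))
    cases b with
    | true =>
      obtain ⟨h1, h2⟩ := hfwd e List.mem_cons_self
      have ih := ih (fun _ => h2) hπ
      have h3 := mul_nonneg hK (hψ (I.src e))
      cases prev <;> simp [forwardBlocksFrom, stepSrc, stepTgt] at ih ⊢ <;> nlinarith
    | false =>
      have h1 := hbwd e List.mem_cons_self
      have ih := ih (by simp) hπ
      cases prev with
      | true =>
        have h3 := mul_nonneg hK (sub_nonneg.2 (hu rfl))
        simp [forwardBlocksFrom, stepSrc, stepTgt] at ih h3 ⊢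
        nlinarith
      | false =>
        simp [forwardBlocksFrom, stepSrc, stepTgt] at ih ⊢
        nlinarith

/-- The price of risk aversion is at most `1 + η γ κ`, where `η` is the number of forward
subpaths of an alternating path. The potentials are the distances from the source with respect
to the edge costs of the two equilibria. -/
theorem socialCost_le_of_weakSteps {γ κ : ℝ} (hγ : 0 ≤ γ) (hκ : 0 ≤ κ) {x z : I.Path → ℝ}
    (hx : I.IsEquilibrium γ x) (hz : I.IsEquilibrium 0 z) (hv : I.VarianceBounded κ x)
    {π : List (I.E × Bool)} (hπ : IsWalk I.stepSrc I.stepTgt I.s π I.t)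
    (hstep : ∀ a ∈ π, I.WeakStep x z a) :
    I.socialCost x ≤ (1 + numForwardSubpaths π * γ * κ) * I.socialCost z := by
  have hK : 0 ≤ γ * κ := mul_nonneg hγ hκ
  have hcx := edgeCost_nonneg hγ hx.1
  have hcz := edgeCost_nonneg le_rfl hz.1
  have key := potential_sub_le (φ := I.dist (I.edgeCost γ x)) (ψ := I.dist (I.edgeCost 0 z))
    (Ψ := I.dist (I.edgeCost 0 z) I.t) hK (dist_nonneg hcz) (π := π) ?_ ?_ false (by simp) hπ
  · rw [dist_source hcx, dist_source hcz] at key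
    have h := mul_le_mul_of_nonneg_left key I.demand_pos.le
    rw [hz.socialCost_eq]
    refine (hx.socialCost_le hγ).trans ?_
    simp only [numForwardSubpaths, Bool.false_eq_true, if_false] at h ⊢
    linarith
  · intro e he
    have hs := hstep _ he
    simp only [WeakStep, if_true] at hs
    obtain ⟨⟨p, hp⟩, h1, h2⟩ := hz.dist_of_edgeFlow_pos le_rfl hs.2
    refine ⟨?_, h2⟩
    have h3 := dist_tgt_le hcx hp
    have h4 := hv e
    have h5 := (I.isLatency_lat e).monotoneOn (edgeFlow_nonneg hx.1 e)
      (edgeFlow_nonneg hz.1 e) hs.1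
    have h6 : I.edgeCost γ x e ≤ (1 + γ * κ) * I.edgeCost 0 z e := by
      have h7 := mul_le_mul_of_nonneg_left h4 hγ
      have h8 := mul_le_mul_of_nonneg_left h5 hK
      simp only [edgeCost]
      linarith
    rw [h1, add_sub_cancel_left]
    linarith
  · intro e he
    have hs := hstep _ he
    simp only [WeakStep, Bool.false_eq_true, if_false] at hs
    obtain ⟨⟨p, hp⟩, h1, -⟩ := hx.dist_of_edgeFlow_pos hγ hs.2
    have h3 := dist_tgt_le hcz hp
    have h5 := (I.isLatency_lat e).monotoneOn (edgeFlow_nonneg hz.1 e)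
      (edgeFlow_nonneg hx.1 e) hs.1
    have h6 := mul_nonneg hγ ((I.isVariance_var e).nonneg _ (edgeFlow_nonneg hx.1 e))
    simp only [edgeCost] at h1 h3 ⊢
    linarith

/-- The set `S` of vertices that can be reached by weak steps contains the sink. Otherwise
`x_e ≥ z_e` on the edges that leave `S` and `x_e ≤ z_e` on those that enter `S`, with strict
inequality on edges in use; as the two flows have the same value, no edge across the cut is
used. -/
theorem exists_weak_alternating_path {x z : I.Path → ℝ} (hx : I.IsFeasible x)
    (hz : I.IsFeasible z) :
    ∃ π, IsSimplePath I.stepSrc I.stepTgt I.s π I.t ∧ ∀ a ∈ π, I.WeakStep x z a := by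
  classical
  let S : Set I.V := {u | ∃ π, IsWalk I.stepSrc I.stepTgt I.s π u ∧ ∀ a ∈ π, I.WeakStep x z a}
  have hsS : I.s ∈ S := ⟨[], rfl, by simp⟩
  have hext {a : I.E × Bool} (ha : I.WeakStep x z a) (hS : I.stepSrc a ∈ S) :
      I.stepTgt a ∈ S := by
    obtain ⟨π, h1, h2⟩ := hS
    refine ⟨π ++ [a], h1.append ⟨rfl, rfl⟩, fun b hb => ?_⟩
    rcases List.mem_append.1 hb with hb | hb
    · exact h2 b hb
    · rwa [List.mem_singleton.1 hb]
  by_cases htS : I.t ∈ S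
  · obtain ⟨π, h1, h2⟩ := htS
    obtain ⟨q, hq, hq'⟩ := h1.exists_isSimplePath
    exact ⟨q, hq', fun a ha => h2 a (hq.subset ha)⟩
  exfalso
  let φ : I.V → ℝ := fun u => if u ∈ S then 1 else 0
  have hφs : φ I.s = 1 := if_pos hsS
  have hφt : φ I.t = 0 := if_neg htS
  have h0x := edgeFlow_nonneg hx
  have h0z := edgeFlow_nonneg hz
  have hterm (e : I.E) : (I.edgeFlow x e - I.edgeFlow z e) * (φ (I.tgt e) - φ (I.src e)) ≤ 0 ∧
      ((I.edgeFlow x e - I.edgeFlow z e) * (φ (I.tgt e) - φ (I.src e)) = 0 →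
        I.edgeFlow x e * (φ (I.tgt e) - φ (I.src e)) = 0) := by
    have hf := hext (a := (e, true))
    have hb := hext (a := (e, false))
    simp only [WeakStep, stepSrc, stepTgt, if_true, Bool.false_eq_true, if_false] at hf hb
    have hx0 := h0x e
    have hz0 := h0z e
    by_cases h1 : I.src e ∈ S <;> by_cases h2 : I.tgt e ∈ S
    · simp [φ, h1, h2]
    · have hf := fun h => h2 (hf h h1)
      simp only [φ, h1, h2, if_true, if_false]
      constructor
      · by_contra! hn
        exact hf ⟨by linarith, by linarith⟩
      · intro h
        by_contra h0
        exact hf ⟨by linarith, lt_of_le_of_ne hz0 fun h3 => h0 (by linarith)⟩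
    · have hb := fun h => h1 (hb h h2)
      simp only [φ, h1, h2, if_true, if_false]
      constructor
      · by_contra! hn
        exact hb ⟨by linarith, by linarith⟩
      · intro h
        by_contra h0
        exact hb ⟨by linarith, lt_of_le_of_ne hx0 fun h3 => h0 (by linarith)⟩
    · simp [φ, h1, h2]
  have hsx := sum_edgeFlow_mul_potential hx φ
  have hsz := sum_edgeFlow_mul_potential hz φ
  have hzero : ∑ e, (I.edgeFlow x e - I.edgeFlow z e) * (φ (I.tgt e) - φ (I.src e)) = 0 := by
    simp only [sub_mul (I.edgeFlow x _), Finset.sum_sub_distrib]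
    linarith
  have hall := (Finset.sum_eq_zero_iff_of_nonpos fun e _ => (hterm e).1).1 hzero
  rw [Finset.sum_eq_zero fun e he => (hterm e).2 (hall e he), hφs, hφt] at hsx
  linarith [I.demand_pos]

end Game

theorem two_mul_forwardBlocksFrom_le {E : Type} (prev : Bool) (π : List (E × Bool)) :
    2 * forwardBlocksFrom prev π ≤ π.length + if prev then 0 else 1 := by
  induction π generalizing prev with
  | nil => simp [forwardBlocksFrom]
  | cons a π ih =>
    obtain ⟨e, b⟩ := a
    have := ih b
    cases b <;> cases prev <;> simp [forwardBlocksFrom] at this ⊢ <;> omega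

/-- Forward subpaths are separated by at least one backward step each, so a path that repeats
no vertex has at most half as many of them as there are vertices. -/
theorem two_mul_numForwardSubpaths_le_card {I : Game} {π : List (I.E × Bool)} {u w : I.V}
    (hπ : IsSimplePath I.stepSrc I.stepTgt u π w) :
    2 * numForwardSubpaths π ≤ Fintype.card I.V := by
  have h1 := two_mul_forwardBlocksFrom_le false π
  have h2 := hπ.2.length_le_card
  simp at h1 h2
  exact h1.trans h2

/-! ### Flows on the recursive construction -/

/-- The edge weights `w` are the edge flow of a non-negative path flow of value `D`. -/
def Network.IsFlow (N : Network) (D : ℝ) (w : N.E → ℝ) : Prop :=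
  ∃ f : N.Path → ℝ, (∀ p, 0 ≤ f p) ∧ ∑ p, f p = D ∧
    ∀ e, (∑ p : N.Path, if e ∈ p.1 then f p else 0) = w e

theorem Network.isFlow_of_weightedPaths (N : Network) {J : Type} [Fintype J]
    (q : J → List N.E) (hq : ∀ j, IsSimplePath N.src N.tgt N.s (q j) N.t)
    (m : J → ℝ) (hm : ∀ j, 0 ≤ m j) :
    N.IsFlow (∑ j, m j) fun e => ∑ j, if e ∈ q j then m j else 0 := by
  classical
  let q' : J → N.Path := fun j => ⟨q j, hq j⟩
  refine ⟨fun p => ∑ j, if q' j = p then m j else 0, fun p => Finset.sum_nonneg fun j _ => ?_,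
    ?_, fun e => ?_⟩
  · split_ifs
    exacts [hm j, le_rfl]
  · rw [Finset.sum_comm]
    simp
  · have h (p : N.Path) : (if e ∈ p.1 then ∑ j, if q' j = p then m j else 0 else 0) =
        ∑ j, if q' j = p then (if e ∈ q j then m j else 0) else 0 := by
      split_ifs with he
      · refine Finset.sum_congr rfl fun j _ => ?_
        split_ifs with h1 h2 <;> first | rfl | exact absurd (show e ∈ (q' j).1 from h1 ▸ he) h2
      · refine (Finset.sum_eq_zero fun j _ => ?_).symm
        split_ifs with h1 h2 <;> first | rfl | exact absurd (h1 ▸ show e ∈ (q' j).1 from h2) he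
    simp only [h]
    rw [Finset.sum_comm]
    simp

section BraessStep

variable {j : ℕ} {N : KindNetwork}

/-- An edge of the upper copy of `N` in the Braess graph. -/
def upperEdge (j : ℕ) (e : N.E) : (braessStep j N).E := Sum.inl (Sum.inl e)

/-- An edge of the lower copy of `N` in the Braess graph. -/
def lowerEdge (j : ℕ) (e : N.E) : (braessStep j N).E := Sum.inl (Sum.inr e)

/-- The further edges of the Braess graph: the link at the source, the vertical edge and the link
at the sink. -/
def outerEdge (j : ℕ) (N : KindNetwork) (k : Fin 3) : (braessStep j N).E := Sum.inr k

/-- A vertex of the upper copy of `N` in the Braess graph. -/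
def upperVertex (j : ℕ) (v : N.V) : (braessStep j N).V := Sum.inl v

/-- A vertex of the lower copy of `N` in the Braess graph. -/
def lowerVertex (j : ℕ) (v : N.V) : (braessStep j N).V := Sum.inr v

theorem upperVertex_injective : Function.Injective (upperVertex j (N := N)) :=
  Sum.inl_injective

theorem lowerVertex_injective : Function.Injective (lowerVertex j (N := N)) :=
  Sum.inr_injective

theorem upperVertex_ne_lowerVertex (u v : N.V) : upperVertex j u ≠ lowerVertex j v :=
  Sum.inl_ne_inr

theorem upperEdge_injective : Function.Injective (upperEdge j (N := N)) :=
  Sum.inl_injective.comp Sum.inl_injective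

theorem lowerEdge_injective : Function.Injective (lowerEdge j (N := N)) :=
  Sum.inl_injective.comp Sum.inr_injective

theorem outerEdge_injective : Function.Injective (outerEdge j N) := Sum.inr_injective

theorem upperEdge_ne_lowerEdge (e e' : N.E) : upperEdge j e ≠ lowerEdge j e' :=
  fun h => Sum.inl_ne_inr (Sum.inl_injective h)

theorem upperEdge_ne_outerEdge (e : N.E) (k : Fin 3) : upperEdge j e ≠ outerEdge j N k :=
  Sum.inl_ne_inr

theorem lowerEdge_ne_outerEdge (e : N.E) (k : Fin 3) : lowerEdge j e ≠ outerEdge j N k :=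
  Sum.inl_ne_inr

/-- To prove a property of all edges of the Braess graph, consider the two copies and the three
further edges. -/
theorem forall_braessStep_edge {P : (braessStep j N).E → Prop}
    (hu : ∀ e, P (upperEdge j e)) (hl : ∀ e, P (lowerEdge j e))
    (h0 : P (outerEdge j N 0)) (h1 : P (outerEdge j N 1)) (h2 : P (outerEdge j N 2)) :
    ∀ e, P e := by
  rintro ((e | e) | k)
  · exact hu e
  · exact hl e
  · fin_cases k
    exacts [h0, h1, h2]

theorem isWalk_upper {p : List N.E} {u w : N.V} (hp : IsWalk N.src N.tgt u p w) :
    IsWalk (braessStep j N).src (braessStep j N).tgt (upperVertex j u) (p.map (upperEdge j))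
      (upperVertex j w) :=
  hp.map (upperEdge j) (upperVertex j) (fun _ => rfl) fun _ => rfl

theorem isWalk_lower {p : List N.E} {u w : N.V} (hp : IsWalk N.src N.tgt u p w) :
    IsWalk (braessStep j N).src (braessStep j N).tgt (lowerVertex j u) (p.map (lowerEdge j))
      (lowerVertex j w) :=
  hp.map (lowerEdge j) (lowerVertex j) (fun _ => rfl) fun _ => rfl

theorem map_tgt_upper (p : List N.E) : (p.map (upperEdge j)).map (braessStep j N).tgt =
    (p.map N.tgt).map (upperVertex j) := by
  rw [List.map_map, List.map_map]
  rfl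

theorem map_tgt_lower (p : List N.E) : (p.map (lowerEdge j)).map (braessStep j N).tgt =
    (p.map N.tgt).map (lowerVertex j) := by
  rw [List.map_map, List.map_map]
  rfl

theorem isSimplePath_upper (p : N.Path) :
    IsSimplePath (braessStep j N).src (braessStep j N).tgt (braessStep j N).s
      (outerEdge j N 0 :: p.1.map (upperEdge j)) (braessStep j N).t := by
  refine ⟨⟨rfl, isWalk_upper p.2.1⟩, ?_⟩
  rw [List.map_cons, map_tgt_upper]
  refine List.nodup_cons.2 ⟨fun h => ?_, p.2.2.map (upperVertex_injective (j := j))⟩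
  obtain ⟨v, -, hv⟩ := List.mem_map.1 (show lowerVertex j N.s ∈
    (N.s :: p.1.map N.tgt).map (upperVertex j) from h)
  exact upperVertex_ne_lowerVertex _ _ hv

theorem isSimplePath_lower (p : N.Path) :
    IsSimplePath (braessStep j N).src (braessStep j N).tgt (braessStep j N).s
      (p.1.map (lowerEdge j) ++ [outerEdge j N 2]) (braessStep j N).t := by
  refine ⟨(isWalk_lower p.2.1).append ⟨rfl, rfl⟩, ?_⟩
  rw [List.map_append, map_tgt_lower]
  refine (List.nodup_append (l₁ := (N.s :: p.1.map N.tgt).map (lowerVertex j))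
    (l₂ := [upperVertex j N.t])).2 ⟨p.2.2.map lowerVertex_injective, List.nodup_singleton _, ?_⟩
  intro a ha b hb hab
  obtain ⟨v, -, rfl⟩ := List.mem_map.1 ha
  rw [List.mem_singleton.1 hb] at hab
  exact upperVertex_ne_lowerVertex _ _ hab.symm

theorem isSimplePath_zigzag :
    IsSimplePath (braessStep j N).src (braessStep j N).tgt (braessStep j N).s
      [outerEdge j N 0, outerEdge j N 1, outerEdge j N 2] (braessStep j N).t := by
  refine ⟨⟨rfl, rfl, rfl, rfl⟩, ?_⟩
  change [lowerVertex j N.s, upperVertex j N.s, lowerVertex j N.t, upperVertex j N.t].Nodup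
  simp [upperVertex_injective.eq_iff, lowerVertex_injective.eq_iff, upperVertex_ne_lowerVertex,
    (upperVertex_ne_lowerVertex _ _).symm, N.s_ne_t]

/-- A flow on `N` in each of the two copies together with `v` units of flow along the zigzag
path through the vertical edge. -/
theorem isFlow_braessStep {D v : ℝ} {w : N.E → ℝ} (h : N.IsFlow D w) (hv : 0 ≤ v)
    {w' : (braessStep j N).E → ℝ} (hu : ∀ e, w' (upperEdge j e) = w e)
    (hl : ∀ e, w' (lowerEdge j e) = w e) (h0 : w' (outerEdge j N 0) = D + v)
    (h1 : w' (outerEdge j N 1) = v) (h2 : w' (outerEdge j N 2) = D + v) :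
    (braessStep j N).IsFlow (2 * D + v) w' := by
  obtain ⟨f, hf0, hD, hw⟩ := h
  have key := (braessStep j N).isFlow_of_weightedPaths (J := (N.Path ⊕ N.Path) ⊕ Unit)
    (Sum.elim (Sum.elim (fun p => outerEdge j N 0 :: p.1.map (upperEdge j))
      fun p => p.1.map (lowerEdge j) ++ [outerEdge j N 2])
      fun _ => [outerEdge j N 0, outerEdge j N 1, outerEdge j N 2]) (by
      rintro ((p | p) | _)
      exacts [isSimplePath_upper p, isSimplePath_lower p, isSimplePath_zigzag])
    (Sum.elim (Sum.elim f f) fun _ => v) (by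
      rintro ((p | p) | _)
      exacts [hf0 p, hf0 p, hv])
  simp only [Fintype.sum_sum_type, Sum.elim_inl, Sum.elim_inr, Finset.univ_unique,
    Finset.sum_singleton, hD] at key
  rw [← two_mul] at key
  convert key using 1
  funext e
  have hlu (e e' : N.E) := (upperEdge_ne_lowerEdge (j := j) e e').symm
  induction e using forall_braessStep_edge <;>
    simp [hu, hl, h0, h1, h2, List.mem_map, upperEdge_injective.eq_iff,
      lowerEdge_injective.eq_iff, outerEdge_injective.eq_iff, upperEdge_ne_outerEdge,
      lowerEdge_ne_outerEdge, upperEdge_ne_lowerEdge, hlu, hw, hD]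

end BraessStep

/-- The flow on an edge of `Gⁱ` when every base edge carries `b` and every vertical edge `v`. -/
def kindFlow (b v : ℝ) : EdgeKind → ℝ
  | .base => b
  | .vertical => v
  | .link j => 2 ^ (j - 1) * (b + v)

theorem isFlow_kindFlow {b v : ℝ} (hb : 0 ≤ b) (hv : 0 ≤ v) (i : ℕ) :
    (recursiveBraess i).IsFlow (2 ^ i * b + (2 ^ i - 1) * v)
      fun e => kindFlow b v ((recursiveBraess i).kind e) := by
  induction i with
  | zero =>
    have key := singleEdge.isFlow_of_weightedPaths (J := Unit)
      (fun _ => [()]) (fun _ => ⟨⟨rfl, rfl⟩, by simp [singleEdge]⟩) (fun _ => b) fun _ => hb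
    rw [pow_zero, one_mul, sub_self, zero_mul, add_zero]
    simp only [Finset.univ_unique, Finset.sum_singleton] at key
    refine (congrArg (singleEdge.IsFlow b) (funext fun e => ?_)).mpr key
    exact (if_pos (List.mem_singleton.2 rfl)).symm
  | succ i ih =>
    have h : kindFlow b v (.link (i + 1)) = 2 ^ i * b + (2 ^ i - 1) * v + v := by
      simp only [kindFlow, Nat.add_sub_cancel]
      ring
    have key := isFlow_braessStep (j := i + 1) ih hv
      (w' := fun e => kindFlow b v ((recursiveBraess (i + 1)).kind e))
      (fun _ => rfl) (fun _ => rfl) h rfl h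
    rw [show (2 : ℝ) ^ (i + 1) * b + (2 ^ (i + 1) - 1) * v =
      2 * (2 ^ i * b + (2 ^ i - 1) * v) + v by ring]
    exact key

/-! ### Potentials on the recursive construction -/

/-- Edge costs that are potential differences on `Gⁱ`. For `δ = 0` they are the costs at the
risk-neutral equilibrium, and for `δ = γ κ` those at the risk-averse one. -/
def kindCost (δ : ℝ) : EdgeKind → ℝ
  | .base => 1 + δ
  | .vertical => 1
  | .link j => 2 ^ (j - 1) * δ

theorem exists_potential_kindCost (δ : ℝ) (i : ℕ) :
    ∃ φ : (recursiveBraess i).V → ℝ, φ (recursiveBraess i).s = 0 ∧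
      φ (recursiveBraess i).t = 1 + 2 ^ i * δ ∧
      ∀ e, kindCost δ ((recursiveBraess i).kind e) =
        φ ((recursiveBraess i).tgt e) - φ ((recursiveBraess i).src e) := by
  induction i with
  | zero =>
    refine ⟨![0, 1 + δ], rfl, by simp [recursiveBraess, singleEdge], fun e => ?_⟩
    simp [recursiveBraess, singleEdge, kindCost]
  | succ i ih =>
    obtain ⟨φ, hs, ht, hφ⟩ := ih
    refine ⟨Sum.elim (fun v => 2 ^ i * δ + φ v) φ, hs, ?_, ?_⟩
    · change 2 ^ i * δ + φ (recursiveBraess i).t = _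
      rw [ht]
      ring
    · have hlink : kindCost δ (.link (i + 1)) = 2 ^ i * δ := rfl
      refine forall_braessStep_edge (j := i + 1) (fun e => ?_) hφ ?_ ?_ ?_
      · refine (hφ e).trans ?_
        change _ = 2 ^ i * δ + φ _ - (2 ^ i * δ + φ _)
        ring
      · change kindCost δ (.link (i + 1)) = 2 ^ i * δ + φ _ - φ _
        rw [hlink, hs]
        ring
      · change 1 = φ (recursiveBraess i).t - (2 ^ i * δ + φ (recursiveBraess i).s)
        rw [hs, ht]
        ring
      · change kindCost δ (.link (i + 1)) = 2 ^ i * δ + φ (recursiveBraess i).t - φ _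
        rw [hlink]
        ring

/-! ### The alternating path of the recursive construction -/

section Steps

/-- The vertex at which the step `(e, b)` starts, see `Game.stepSrc`. -/
def Network.stepSrc (N : Network) (a : N.E × Bool) : N.V :=
  if a.2 then N.src a.1 else N.tgt a.1

/-- The vertex at which the step `(e, b)` ends, see `Game.stepTgt`. -/
def Network.stepTgt (N : Network) (a : N.E × Bool) : N.V :=
  if a.2 then N.tgt a.1 else N.src a.1

/-- The steps that traverse base edges forward and all other edges backward. -/
def KindNetwork.Allowed (N : KindNetwork) (a : N.E × Bool) : Prop :=
  a.2 = true ↔ N.kind a.1 = .base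

/-- An enumeration of the vertices, from the source to the sink, in the order in which the
alternating path visits them: an allowed step leads to the next vertex or to an earlier one, and
at most one allowed step leads from a vertex to the next. -/
structure KindNetwork.IsPosition (N : KindNetwork) (m : ℕ) (pos : N.V → ℕ) : Prop where
  injective : Function.Injective pos
  lt : ∀ v, pos v < m
  source : pos N.s = 0
  sink : pos N.t + 1 = m
  next_or_lt : ∀ a, N.Allowed a →
    pos (N.stepTgt a) = pos (N.stepSrc a) + 1 ∨ pos (N.stepTgt a) < pos (N.stepSrc a)
  eq_of_next : ∀ a a', N.Allowed a → N.Allowed a' → N.stepSrc a = N.stepSrc a' →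
    pos (N.stepTgt a) = pos (N.stepSrc a) + 1 → pos (N.stepTgt a') = pos (N.stepSrc a') + 1 →
    a = a'

variable {N : KindNetwork} {m : ℕ} {pos : N.V → ℕ}

/-- A step in the upper copy of `N` in the Braess graph. -/
def upperStep (j : ℕ) (a : N.E × Bool) : (braessStep j N).E × Bool := (upperEdge j a.1, a.2)

/-- A step in the lower copy of `N` in the Braess graph. -/
def lowerStep (j : ℕ) (a : N.E × Bool) : (braessStep j N).E × Bool := (lowerEdge j a.1, a.2)

theorem stepSrc_upperStep (j : ℕ) (a : N.E × Bool) :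
    (braessStep j N).stepSrc (upperStep j a) = upperVertex j (N.stepSrc a) := by
  obtain ⟨e, _ | _⟩ := a <;> rfl

theorem stepTgt_upperStep (j : ℕ) (a : N.E × Bool) :
    (braessStep j N).stepTgt (upperStep j a) = upperVertex j (N.stepTgt a) := by
  obtain ⟨e, _ | _⟩ := a <;> rfl

theorem stepSrc_lowerStep (j : ℕ) (a : N.E × Bool) :
    (braessStep j N).stepSrc (lowerStep j a) = lowerVertex j (N.stepSrc a) := by
  obtain ⟨e, _ | _⟩ := a <;> rfl

theorem stepTgt_lowerStep (j : ℕ) (a : N.E × Bool) :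
    (braessStep j N).stepTgt (lowerStep j a) = lowerVertex j (N.stepTgt a) := by
  obtain ⟨e, _ | _⟩ := a <;> rfl

/-- Outside the two copies, only the backward traversals of the three further edges are allowed. -/
theorem KindNetwork.allowed_braessStep {j : ℕ} {a : (braessStep j N).E × Bool}
    (ha : (braessStep j N).Allowed a) :
    (∃ a', N.Allowed a' ∧ a = upperStep j a') ∨ (∃ a', N.Allowed a' ∧ a = lowerStep j a') ∨
      a = (outerEdge j N 0, false) ∨ a = (outerEdge j N 1, false) ∨
      a = (outerEdge j N 2, false) := by
  obtain ⟨e, b⟩ := a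
  have hb (h : (braessStep j N).kind e ≠ .base) : b = false := by
    cases b
    exacts [rfl, absurd (ha.1 rfl) h]
  induction e using forall_braessStep_edge with
  | hu e => exact Or.inl ⟨(e, b), ha, rfl⟩
  | hl e => exact Or.inr (Or.inl ⟨(e, b), ha, rfl⟩)
  | h0 => simp [hb (fun h => by cases h)]
  | h1 => simp [hb (fun h => by cases h)]
  | h2 => simp [hb (fun h => by cases h)]

/-- The enumeration of the lower copy followed by that of the upper copy. The vertical edge leads
backward from the last vertex of the lower copy to the first one of the upper copy, and the two
links lead backward to the lower copy. -/
theorem KindNetwork.IsPosition.braessStep (h : N.IsPosition m pos) (j : ℕ) :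
    ∃ pos', (braessStep j N).IsPosition (2 * m) pos' := by
  let pos' : (RiskRouting.braessStep j N).V → ℕ := Sum.elim (fun v => m + pos v) pos
  have hpu (v : N.V) : pos' (upperVertex j v) = m + pos v := rfl
  have hpl (v : N.V) : pos' (lowerVertex j v) = pos v := rfl
  have h0 : (RiskRouting.braessStep j N).stepSrc (outerEdge j N 0, false) = upperVertex j N.s ∧
      (RiskRouting.braessStep j N).stepTgt (outerEdge j N 0, false) = lowerVertex j N.s :=
    ⟨rfl, rfl⟩
  have h1 : (RiskRouting.braessStep j N).stepSrc (outerEdge j N 1, false) = lowerVertex j N.t ∧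
      (RiskRouting.braessStep j N).stepTgt (outerEdge j N 1, false) = upperVertex j N.s :=
    ⟨rfl, rfl⟩
  have h2 : (RiskRouting.braessStep j N).stepSrc (outerEdge j N 2, false) = upperVertex j N.t ∧
      (RiskRouting.braessStep j N).stepTgt (outerEdge j N 2, false) = lowerVertex j N.t :=
    ⟨rfl, rfl⟩
  have hs := h.source
  have ht := h.sink
  have hlt (v : (RiskRouting.braessStep j N).V) : pos' v < 2 * m := by
    rcases v with v | v
    · exact (Nat.add_lt_add_left (h.lt v) m).trans_eq (two_mul m).symm
    · exact (h.lt v).trans_le (Nat.le_mul_of_pos_left m two_pos)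
  refine ⟨pos', ?_, hlt, hs, ?_, ?_, ?_⟩
  · rintro (u | u) (v | v) huv
    · exact congrArg _ (h.injective (Nat.add_left_cancel huv))
    · exact absurd (h.lt v) (not_lt.2 ((Nat.le_add_right m (pos u)).trans_eq huv))
    · exact absurd (h.lt u) (not_lt.2 ((Nat.le_add_right m (pos v)).trans_eq huv.symm))
    · exact congrArg _ (h.injective huv)
  · change m + pos N.t + 1 = 2 * m
    omega
  · intro a ha
    rcases KindNetwork.allowed_braessStep ha with
      ⟨a, ha', rfl⟩ | ⟨a, ha', rfl⟩ | rfl | rfl | rfl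
    · have := h.next_or_lt a ha'
      simp only [stepSrc_upperStep, stepTgt_upperStep, hpu]
      omega
    · have := h.next_or_lt a ha'
      simp only [stepSrc_lowerStep, stepTgt_lowerStep, hpl]
      omega
    all_goals simp only [h0, h1, h2, hpu, hpl]; omega
  · intro a a' ha ha' hsrc hn hn'
    have hvert := upperVertex_ne_lowerVertex (N := N) (j := j)
    have hvert' (u v : N.V) := (hvert u v).symm
    rcases KindNetwork.allowed_braessStep ha with
      ⟨a, hA, rfl⟩ | ⟨a, hA, rfl⟩ | rfl | rfl | rfl <;>
    rcases KindNetwork.allowed_braessStep ha' with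
      ⟨a', hA', rfl⟩ | ⟨a', hA', rfl⟩ | rfl | rfl | rfl <;>
    simp only [stepSrc_upperStep, stepTgt_upperStep, stepSrc_lowerStep, stepTgt_lowerStep, h0, h1,
      h2, hpu, hpl, upperVertex_injective.eq_iff, lowerVertex_injective.eq_iff, hvert,
      hvert'] at hsrc hn hn' <;>
    first
    | rfl
    | omega
    | (rw [h.eq_of_next a a' hA hA' hsrc (by omega) (by omega)])
    | (have := h.lt (N.stepTgt a); rw [hsrc] at hn; omega)
    | (have := h.lt (N.stepTgt a'); rw [← hsrc] at hn'; omega)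

/-- A simple path of allowed steps always proceeds to the next vertex: if all vertices up to the
position of `u` have been visited, a step to an earlier one is impossible. -/
theorem KindNetwork.IsPosition.forall_next (h : N.IsPosition m pos) {π : List (N.E × Bool)}
    {u w : N.V} {S : Set N.V} (hS : ∀ v, pos v ≤ pos u → v ∈ S)
    (hπ : IsWalk N.stepSrc N.stepTgt u π w) (hall : ∀ a ∈ π, N.Allowed a)
    (hnd : (π.map N.stepTgt).Nodup) (hdisj : ∀ a ∈ π, N.stepTgt a ∉ S) :
    ∀ a ∈ π, pos (N.stepTgt a) = pos (N.stepSrc a) + 1 := by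
  induction π generalizing u S with
  | nil => simp
  | cons a π ih =>
    obtain ⟨rfl, hπ⟩ := hπ
    have hnext : pos (N.stepTgt a) = pos (N.stepSrc a) + 1 :=
      (h.next_or_lt a (hall a List.mem_cons_self)).resolve_right fun hlt =>
        hdisj a List.mem_cons_self (hS _ hlt.le)
    rw [List.map_cons, List.nodup_cons] at hnd
    rintro b hb
    rcases List.mem_cons.1 hb with rfl | hb
    · exact hnext
    refine ih (S := insert (N.stepTgt a) S) (fun v hv => ?_) hπ
      (fun c hc => hall c (List.mem_cons_of_mem _ hc)) hnd.2 (fun c hc => ?_) b hb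
    · rcases hv.eq_or_lt with hv | hv
      · exact Or.inl (h.injective hv)
      · exact Or.inr (hS v (by omega))
    · rintro (hc' | hc')
      · exact hnd.1 (hc' ▸ List.mem_map_of_mem hc)
      · exact hdisj c (List.mem_cons_of_mem _ hc) hc'

theorem KindNetwork.IsPosition.le_of_walk {π : List (N.E × Bool)} {u w : N.V}
    (hπ : IsWalk N.stepSrc N.stepTgt u π w)
    (hnext : ∀ a ∈ π, pos (N.stepTgt a) = pos (N.stepSrc a) + 1) :
    pos w = pos u + π.length := by
  induction π generalizing u with
  | nil => simp [show u = w from hπ]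
  | cons a π ih =>
    obtain ⟨rfl, hπ⟩ := hπ
    rw [ih hπ fun b hb => hnext b (List.mem_cons_of_mem _ hb), hnext a List.mem_cons_self,
      List.length_cons]
    omega

theorem KindNetwork.IsPosition.walk_unique (h : N.IsPosition m pos)
    {π π' : List (N.E × Bool)} {u w : N.V}
    (hπ : IsWalk N.stepSrc N.stepTgt u π w) (hall : ∀ a ∈ π, N.Allowed a)
    (hnext : ∀ a ∈ π, pos (N.stepTgt a) = pos (N.stepSrc a) + 1)
    (hπ' : IsWalk N.stepSrc N.stepTgt u π' w) (hall' : ∀ a ∈ π', N.Allowed a)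
    (hnext' : ∀ a ∈ π', pos (N.stepTgt a) = pos (N.stepSrc a) + 1) : π = π' := by
  have hlen : π.length = π'.length := by
    have h1 := le_of_walk hπ hnext
    have h2 := le_of_walk hπ' hnext'
    omega
  induction π generalizing u π' with
  | nil => exact (List.length_eq_zero_iff.1 hlen.symm).symm
  | cons a π ih =>
    cases π' with
    | nil => simp at hlen
    | cons a' π' =>
      simp only [List.forall_mem_cons] at hall hall' hnext hnext'
      obtain ⟨hs, hπ⟩ := hπ
      obtain ⟨hs', hπ'⟩ := hπ'
      obtain rfl := h.eq_of_next a a' hall.1 hall'.1 (hs.trans hs'.symm) hnext.1 hnext'.1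
      rw [ih hπ hall.2 hnext.2 hπ' hall'.2 hnext'.2 (by simpa using hlen)]

theorem KindNetwork.IsPosition.simplePath_unique (h : N.IsPosition m pos)
    {π π' : List (N.E × Bool)}
    (hπ : IsSimplePath N.stepSrc N.stepTgt N.s π N.t) (hall : ∀ a ∈ π, N.Allowed a)
    (hπ' : IsSimplePath N.stepSrc N.stepTgt N.s π' N.t) (hall' : ∀ a ∈ π', N.Allowed a) :
    π = π' := by
  have key {q : List (N.E × Bool)} (hq : IsSimplePath N.stepSrc N.stepTgt N.s q N.t)
      (hall : ∀ a ∈ q, N.Allowed a) :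
      ∀ a ∈ q, pos (N.stepTgt a) = pos (N.stepSrc a) + 1 := by
    obtain ⟨hns, hnd⟩ := List.nodup_cons.1 hq.2
    refine h.forall_next (S := {N.s}) (fun v hv => ?_) hq.1 hall hnd fun a ha hs => ?_
    · rw [h.source] at hv
      exact h.injective (by rw [h.source]; omega)
    · exact hns (hs ▸ List.mem_map_of_mem ha)
  exact h.walk_unique hπ.1 hall (key hπ hall) hπ'.1 hall' (key hπ' hall')

end Steps

theorem exists_isPosition (i : ℕ) :
    ∃ pos, (recursiveBraess i).IsPosition (2 ^ (i + 1)) pos := by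
  induction i with
  | zero =>
    refine ⟨fun v => v.val, Fin.val_injective, fun v => v.isLt, rfl, rfl, ?_, ?_⟩
    · rintro ⟨e, b⟩ ha
      have : b = true := ha.2 rfl
      subst this
      exact Or.inl rfl
    · rintro ⟨e, b⟩ ⟨e', b'⟩ ha ha' - - -
      exact Prod.ext rfl ((ha.2 rfl).trans (ha'.2 rfl).symm)
  | succ i ih =>
    obtain ⟨pos, h⟩ := ih
    rw [pow_succ' 2 (i + 1)]
    exact h.braessStep (i + 1)

section AltPath

variable {j : ℕ} {N : KindNetwork}

/-- The path through the Braess graph that runs through the lower copy, backward along the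
vertical edge and through the upper copy. -/
def joinCopies (j : ℕ) (π : List (N.E × Bool)) : List ((braessStep j N).E × Bool) :=
  π.map (lowerStep j) ++ (outerEdge j N 1, false) :: π.map (upperStep j)

theorem isSimplePath_joinCopies {π : List (N.E × Bool)}
    (h : IsSimplePath N.stepSrc N.stepTgt N.s π N.t) :
    IsSimplePath (braessStep j N).stepSrc (braessStep j N).stepTgt (braessStep j N).s
      (joinCopies j π) (braessStep j N).t := by
  obtain ⟨hw, hnd⟩ := h
  refine ⟨(hw.map (lowerStep j) (lowerVertex j) (stepSrc_lowerStep j) (stepTgt_lowerStep j)).append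
    ⟨rfl, hw.map (upperStep j) (upperVertex j) (stepSrc_upperStep j) (stepTgt_upperStep j)⟩, ?_⟩
  have hlo : (π.map (lowerStep j)).map (braessStep j N).stepTgt =
      (π.map N.stepTgt).map (lowerVertex j) := by
    simp only [List.map_map, Function.comp_def, stepTgt_lowerStep]
  have hup : (π.map (upperStep j)).map (braessStep j N).stepTgt =
      (π.map N.stepTgt).map (upperVertex j) := by
    simp only [List.map_map, Function.comp_def, stepTgt_upperStep]
  rw [joinCopies, List.map_append, List.map_cons, hlo, hup]
  refine (List.nodup_append (l₁ := (N.s :: π.map N.stepTgt).map (lowerVertex j))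
    (l₂ := (N.s :: π.map N.stepTgt).map (upperVertex j))).2
    ⟨hnd.map lowerVertex_injective, hnd.map upperVertex_injective, ?_⟩
  intro a ha b hb hab
  obtain ⟨u, -, rfl⟩ := List.mem_map.1 ha
  obtain ⟨v, -, rfl⟩ := List.mem_map.1 hb
  exact upperVertex_ne_lowerVertex _ _ hab.symm

theorem allowed_joinCopies {π : List (N.E × Bool)} (h : ∀ a ∈ π, N.Allowed a) :
    ∀ a ∈ joinCopies j π, (braessStep j N).Allowed a := by
  intro a ha
  rcases List.mem_append.1 ha with ha | ha
  · obtain ⟨b, hb, rfl⟩ := List.mem_map.1 ha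
    exact h b hb
  · rcases List.mem_cons.1 ha with rfl | ha
    · exact iff_of_false (by simp) fun h => EdgeKind.noConfusion h
    · obtain ⟨b, hb, rfl⟩ := List.mem_map.1 ha
      exact h b hb

end AltPath

/-- The alternating path of `Gⁱ`. -/
def altPath : (i : ℕ) → List ((recursiveBraess i).E × Bool)
  | 0 => [((), true)]
  | i + 1 => joinCopies (i + 1) (altPath i)

theorem isSimplePath_altPath (i : ℕ) :
    IsSimplePath (recursiveBraess i).stepSrc (recursiveBraess i).stepTgt (recursiveBraess i).s
      (altPath i) (recursiveBraess i).t := by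
  induction i with
  | zero => exact ⟨⟨rfl, rfl⟩, by simp [altPath, Network.stepTgt, recursiveBraess, singleEdge]⟩
  | succ i ih => exact isSimplePath_joinCopies ih

theorem allowed_altPath (i : ℕ) : ∀ a ∈ altPath i, (recursiveBraess i).Allowed a := by
  induction i with
  | zero =>
    intro a ha
    rw [List.mem_singleton.1 ha]
    exact iff_of_true rfl rfl
  | succ i ih => exact allowed_joinCopies ih

theorem forwardBlocksFrom_map {E E' : Type} (f : E → E') (prev : Bool) (π : List (E × Bool)) :
    forwardBlocksFrom prev (π.map fun a => (f a.1, a.2)) = forwardBlocksFrom prev π := by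
  induction π generalizing prev with
  | nil => rfl
  | cons a π ih => simp [forwardBlocksFrom, ih]

theorem forwardBlocksFrom_append_backward {E : Type} (prev : Bool) (p q : List (E × Bool))
    (e : E) : forwardBlocksFrom prev (p ++ (e, false) :: q) =
      forwardBlocksFrom prev p + forwardBlocksFrom false q := by
  induction p generalizing prev with
  | nil => simp [forwardBlocksFrom]
  | cons a p ih => simp [forwardBlocksFrom, ih, add_assoc]

theorem numForwardSubpaths_joinCopies {N : KindNetwork} (j : ℕ) (π : List (N.E × Bool)) :
    numForwardSubpaths (joinCopies j π) = 2 * numForwardSubpaths π := by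
  rw [numForwardSubpaths, joinCopies, forwardBlocksFrom_append_backward, two_mul]
  exact congrArg₂ _ (forwardBlocksFrom_map _ _ _) (forwardBlocksFrom_map _ _ _)

theorem numForwardSubpaths_altPath (i : ℕ) : numForwardSubpaths (altPath i) = 2 ^ i := by
  induction i with
  | zero => rfl
  | succ i ih => exact (numForwardSubpaths_joinCopies _ _).trans (by rw [ih, pow_succ'])

theorem card_recursiveBraess (i : ℕ) : Fintype.card (recursiveBraess i).V = 2 ^ (i + 1) := by
  induction i with
  | zero => rfl
  | succ i ih =>
    have h : Fintype.card (recursiveBraess (i + 1)).V =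
        Fintype.card ((recursiveBraess i).V ⊕ (recursiveBraess i).V) := rfl
    rw [h, Fintype.card_sum, ih]
    ring

/-! ### Equilibria of the recursive construction -/

/-- The latency function `a_j` of the links of level `j`: it vanishes up to flow `2 ^ (j - 1) q`
and increases linearly from there, with value `2 ^ (j - 1) δ` at flow `2 ^ (j - 1) r`. -/
noncomputable def linkLatency (δ q r : ℝ) (j : ℕ) (y : ℝ) : ℝ :=
  2 ^ (j - 1) * δ * max 0 ((y / 2 ^ (j - 1) - q) / (r - q))

section LinkLatency

variable {δ q r : ℝ}

theorem isLatency_linkLatency (hδ : 0 ≤ δ) (hqr : q < r) (j : ℕ) :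
    IsLatency (linkLatency δ q r j) where
  continuousOn := by
    unfold linkLatency
    fun_prop
  monotoneOn := by
    intro y _ y' _ hy
    have : 0 ≤ r - q := (sub_pos.2 hqr).le
    unfold linkLatency
    gcongr
  nonneg y _ := by
    unfold linkLatency
    positivity

theorem linkLatency_left (j : ℕ) : linkLatency δ q r j (2 ^ (j - 1) * q) = 0 := by
  simp [linkLatency]

theorem linkLatency_right (hqr : q < r) (j : ℕ) :
    linkLatency δ q r j (2 ^ (j - 1) * r) = 2 ^ (j - 1) * δ := by
  simp [linkLatency, div_self (sub_pos.2 hqr).ne']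

/-- The latency is not capped at flow `2 ^ (j - 1) r`, so that its value there determines the flow.
If `γ κ ≠ 0`, this forces the links to carry the same flow in all risk-averse equilibria. -/
theorem eq_of_linkLatency_eq (hδ : δ ≠ 0) (hqr : q < r) {j : ℕ} {y : ℝ}
    (h : linkLatency δ q r j y = 2 ^ (j - 1) * δ) : y = 2 ^ (j - 1) * r := by
  have hne : (2 : ℝ) ^ (j - 1) * δ ≠ 0 := mul_ne_zero (by positivity) hδ
  have h1 : max 0 ((y / 2 ^ (j - 1) - q) / (r - q)) = 1 :=
    mul_left_cancel₀ hne (h.trans (mul_one _).symm)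
  have h2 : (y / 2 ^ (j - 1) - q) / (r - q) = 1 := by
    rcases max_choice 0 ((y / 2 ^ (j - 1) - q) / (r - q)) with h3 | h3
    · exact absurd (h3.symm.trans h1) zero_ne_one
    · exact h3.symm.trans h1
  rw [div_eq_one_iff_eq (sub_pos.2 hqr).ne', sub_left_inj, div_eq_iff (by positivity)] at h2
  rw [h2, mul_comm]

end LinkLatency

/-- The properties of the instances on `Gⁱ` that determine their equilibria and alternating paths,
for an arbitrary instance with a type assigned to each edge. -/
structure IsRecursiveLike (I : Game) (i : ℕ) (κ : ℝ) (a : ℕ → ℝ → ℝ) (kind : I.E → EdgeKind) :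
    Prop where
  lat_eq : ∀ e, I.lat e = kindLatency a (kind e)
  var_eq : ∀ e, I.var e = kindVariance κ (kind e)
  flow : ∀ b v, 0 ≤ b → 0 ≤ v →
    I.IsFlow (2 ^ i * b + (2 ^ i - 1) * v) fun e => kindFlow b v (kind e)
  potential : ∀ δ, ∃ φ : I.V → ℝ, φ I.s = 0 ∧ φ I.t = 1 + 2 ^ i * δ ∧
    ∀ e, kindCost δ (kind e) = φ (I.tgt e) - φ (I.src e)
  alternating : ∃ π, IsSimplePath I.stepSrc I.stepTgt I.s π I.t ∧
    (∀ a ∈ π, (a.2 = true ↔ kind a.1 = .base)) ∧ numForwardSubpaths π = 2 ^ i ∧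
    ∀ π', IsSimplePath I.stepSrc I.stepTgt I.s π' I.t →
      (∀ a ∈ π', (a.2 = true ↔ kind a.1 = .base)) → π' = π

theorem isRecursiveLike_recursiveGame (i : ℕ) {d κ : ℝ} (hd : 0 < d) (hκ : 0 ≤ κ)
    {a : ℕ → ℝ → ℝ} (ha : ∀ j, IsLatency (a j)) :
    IsRecursiveLike (recursiveGame i hd hκ a ha) i κ a (recursiveBraess i).kind where
  lat_eq _ := rfl
  var_eq _ := rfl
  flow _ _ hb hv := isFlow_kindFlow hb hv i
  potential δ := exists_potential_kindCost δ i
  alternating := by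
    obtain ⟨pos, hpos⟩ := exists_isPosition i
    exact ⟨altPath i, isSimplePath_altPath i, allowed_altPath i, numForwardSubpaths_altPath i,
      fun π' h h' => hpos.simplePath_unique h h' (isSimplePath_altPath i) (allowed_altPath i)⟩

namespace IsRecursiveLike

variable {I : Game} {i : ℕ} {κ : ℝ} {a : ℕ → ℝ → ℝ} {kind : I.E → EdgeKind}

theorem monotoneOn_edgeCost (h : IsRecursiveLike I i κ a kind) (γ : ℝ) (e : I.E) :
    MonotoneOn (fun y => I.lat e y + γ * I.var e y) (Set.Ici 0) := by
  obtain ⟨r, hr⟩ : ∃ r, I.var e = fun _ => r := by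
    rw [h.var_eq]
    cases kind e
    exacts [⟨κ, rfl⟩, ⟨0, rfl⟩, ⟨0, rfl⟩]
  rw [hr]
  exact (I.isLatency_lat e).monotoneOn.add_const _

theorem sum_edgeFlow_mul_kindCost (h : IsRecursiveLike I i κ a kind) {f : I.Path → ℝ}
    (hf : I.IsFeasible f) (δ : ℝ) :
    ∑ e, I.edgeFlow f e * kindCost δ (kind e) = I.demand * (1 + 2 ^ i * δ) := by
  obtain ⟨φ, hs, ht, hφ⟩ := h.potential δ
  simp only [hφ]
  rw [Game.sum_edgeFlow_mul_potential hf φ, hs, ht, sub_zero]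

theorem edgeCost_eq (h : IsRecursiveLike I i κ a kind) (γ : ℝ) (f : I.Path → ℝ) (e : I.E) :
    I.edgeCost γ f e = kindLatency a (kind e) (I.edgeFlow f e) +
      γ * kindVariance κ (kind e) (I.edgeFlow f e) := by
  rw [Game.edgeCost, h.lat_eq, h.var_eq]

theorem exists_isEquilibrium (h : IsRecursiveLike I i κ a kind) {γ b v δ : ℝ} (hb : 0 ≤ b)
    (hv : 0 ≤ v) (hbv : 2 ^ i * b + (2 ^ i - 1) * v = I.demand)
    (hcost : ∀ k, kindLatency a k (kindFlow b v k) + γ * kindVariance κ k (kindFlow b v k) =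
      kindCost δ k) :
    ∃ f, I.IsEquilibrium γ f ∧ (∀ e, I.edgeFlow f e = kindFlow b v (kind e)) ∧
      ∀ e, I.edgeCost γ f e = kindCost δ (kind e) := by
  obtain ⟨f, h0, hsum, hf⟩ := h.flow b v hb hv
  have hf' (e) : I.edgeFlow f e = kindFlow b v (kind e) := hf e
  have hc (e) : I.edgeCost γ f e = kindCost δ (kind e) := by rw [h.edgeCost_eq, hf', hcost]
  obtain ⟨φ, -, -, hφ⟩ := h.potential δ
  exact ⟨f, Game.isEquilibrium_of_potential ⟨h0, hsum.trans hbv⟩ φ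
    fun e => (hc e).trans (hφ e), hf', hc⟩

/-- The latencies are such that the link costs vanish at the risk-neutral equilibrium, in which
each base edge carries `q`, and are `2 ^ (j - 1) γ κ` at the risk-averse one, in which each
vertical edge carries `r`. By uniqueness of the edge costs, all equilibria have these edge costs,
which are potential differences. -/
theorem isTightInstance {γ q r : ℝ} (hγ : 0 ≤ γ) (hκ : 0 ≤ κ) (hq : 0 < q) (hqr : q < r)
    (h : IsRecursiveLike I i κ (linkLatency (γ * κ) q r) kind)
    (hdq : 2 ^ i * q = I.demand) (hdr : (2 ^ i - 1) * r = I.demand) :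
    IsTightInstance γ κ (2 ^ i) I := by
  have hr : 0 < r := hq.trans hqr
  have hδ : 0 ≤ γ * κ := mul_nonneg hγ hκ
  obtain ⟨x, hx, hxe, hxc⟩ := h.exists_isEquilibrium (γ := γ) (δ := γ * κ) le_rfl hr.le
    (by rw [mul_zero, zero_add, hdr]) (by
      rintro (_ | _ | j) <;> simp [kindLatency, kindVariance, kindCost, kindFlow,
        linkLatency_right hqr])
  obtain ⟨z, hz, hze, hzc⟩ := h.exists_isEquilibrium (γ := 0) (δ := 0) hq.le le_rfl
    (by rw [mul_zero, add_zero, hdq]) (by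
      rintro (_ | _ | j) <;> simp [kindLatency, kindCost, kindFlow, linkLatency_left])
  constructor
  · intro z' hz'
    rw [Game.socialCost_eq_sum]
    have hsum := h.sum_edgeFlow_mul_kindCost hz'.1 0
    rw [mul_zero, add_zero, mul_one] at hsum
    refine Eq.trans (Finset.sum_congr rfl fun e _ => ?_) hsum
    have := hz'.edgeCost_eq (h.monotoneOn_edgeCost 0) hz e
    rw [hzc, Game.edgeCost, zero_mul, add_zero] at this
    rw [this]
  · intro x' hx'
    have hx0 := Game.edgeFlow_nonneg hx'.1
    refine ⟨fun e => ?_, ?_⟩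
    · rw [h.var_eq, h.lat_eq]
      cases kind e with
      | base => exact (mul_one κ).ge
      | vertical => exact mul_nonneg hκ zero_le_one
      | link j => exact mul_nonneg hκ ((isLatency_linkLatency hδ hqr j).nonneg _ (hx0 e))
    · -- On every edge, the difference of the potential cost and the mean latency, weighted with
      -- the flow `x'`, agrees with an expression whose sum over the edges vanishes.
      have hterm (e : I.E) :
          I.edgeFlow x' e * kindCost (γ * κ) (kind e) -
              I.edgeFlow x' e * I.lat e (I.edgeFlow x' e) =
            (I.edgeFlow x' e - I.edgeFlow x e) * (kindCost (γ * κ) (kind e) -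
              kindCost 0 (kind e)) := by
        have hc := hx'.edgeCost_eq (h.monotoneOn_edgeCost γ) hx e
        rw [hxc, h.edgeCost_eq] at hc
        rw [hxe, h.lat_eq]
        generalize kind e = k at hc ⊢
        cases k with
        | base => simp only [kindLatency, kindCost, kindFlow]; ring
        | vertical => simp only [kindLatency, kindCost]; ring
        | link j =>
          simp only [kindLatency, kindVariance, kindCost, kindFlow, mul_zero, add_zero,
            zero_add] at hc ⊢
          rw [hc, sub_self, sub_zero]
          rcases eq_or_ne (γ * κ) 0 with h0 | h0
          · rw [h0, mul_zero, mul_zero]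
          · rw [eq_of_linkLatency_eq h0 hqr hc, sub_self, zero_mul]
      have h1 := h.sum_edgeFlow_mul_kindCost hx'.1 (γ * κ)
      have h2 := h.sum_edgeFlow_mul_kindCost hx.1 (γ * κ)
      have h3 := h.sum_edgeFlow_mul_kindCost hx'.1 0
      have h4 := h.sum_edgeFlow_mul_kindCost hx.1 0
      have hsum := Finset.sum_congr (s₁ := Finset.univ) rfl fun e _ => hterm e
      simp only [sub_mul, mul_sub, Finset.sum_sub_distrib] at hsum
      rw [Game.socialCost_eq_sum]
      push_cast
      linarith
  · have hA (e : I.E) : I.InA x z e ↔ kind e = .base := by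
      rw [Game.InA, hxe, hze]
      cases kind e with
      | base => simpa [kindFlow] using hq
      | vertical => simpa [kindFlow] using hr.le
      | link j => simpa [kindFlow] using hqr.le
    have hused (e : I.E) : I.Used x z e := by
      rw [Game.Used, hxe, hze]
      cases kind e with
      | base => exact Or.inr hq
      | vertical => exact Or.inl hr
      | link j => exact Or.inl (by simpa [kindFlow] using hr)
    have hstep (a : I.E × Bool) : (I.Used x z a.1 ∧
        if a.2 then I.InA x z a.1 else I.InB x z a.1) ↔ (a.2 = true ↔ kind a.1 = .base) := by
      have hB : I.InB x z a.1 ↔ ¬ I.InA x z a.1 := not_lt.symm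
      rw [and_iff_right (hused a.1), hB, hA]
      obtain ⟨e, _ | _⟩ := a <;> simp
    obtain ⟨π, hπ, hall, hnum, huniq⟩ := h.alternating
    exact ⟨x, z, hx, hz, hused, π, ⟨hπ, fun a ha => (hstep a).2 (hall a ha)⟩, hnum,
      fun π' hπ' => huniq π' hπ'.1 fun a ha => (hstep a).1 (hπ'.2 a ha)⟩

end IsRecursiveLike

theorem exists_isTightInstance {γ κ : ℝ} (hγ : 0 ≤ γ) (hκ : 0 ≤ κ) {i : ℕ} (hi : 1 ≤ i) {d : ℝ}
    (hd : 0 < d) : ∃ (a : ℕ → ℝ → ℝ) (ha : ∀ j, IsLatency (a j)),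
      IsTightInstance γ κ (2 ^ i) (recursiveGame i hd hκ a ha) := by
  -- The flow on the base edges when only these share the demand, and the flow on the vertical edges
  -- when only these do: there are `2 ^ i` and `2 ^ i - 1` of them.
  have h2 : (1 : ℝ) < 2 ^ i := one_lt_pow₀ one_lt_two (by omega)
  have h2' : (0 : ℝ) < 2 ^ i - 1 := sub_pos.2 h2
  have hqr : d / 2 ^ i < d / (2 ^ i - 1) := div_lt_div_of_pos_left hd h2' (sub_one_lt _)
  refine ⟨linkLatency (γ * κ) (d / 2 ^ i) (d / (2 ^ i - 1)),
    isLatency_linkLatency (mul_nonneg hγ hκ) hqr, ?_⟩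
  exact (isRecursiveLike_recursiveGame i hd hκ _).isTightInstance hγ hκ (by positivity) hqr
    (mul_div_cancel₀ d (by positivity)) (mul_div_cancel₀ d h2'.ne')

/-! ### Two parallel edges -/

/-- Unit demand over two parallel edges: a risky one with latency `1` and variance `κ`, and a safe
one with latency `1 + δ y`. -/
noncomputable abbrev parallelGame {δ κ : ℝ} (hδ : 0 ≤ δ) (hκ : 0 ≤ κ) : Game where
  V := Fin 2
  E := Bool
  src := fun _ => 0
  tgt := fun _ => 1
  s := 0
  t := 1
  s_ne_t := by decide
  demand := 1
  demand_pos := one_pos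
  lat := fun risky y => if risky then 1 else 1 + δ * y
  var := fun risky _ => if risky then κ else 0
  isLatency_lat := by
    rintro (_ | _)
    · refine ⟨by simp only [Bool.false_eq_true, if_false]; fun_prop, fun y _ y' _ h => ?_,
        fun y hy => ?_⟩
      · simp only [Bool.false_eq_true, if_false]
        gcongr
      · simp only [Bool.false_eq_true, if_false]
        positivity
    · exact ⟨continuousOn_const, monotoneOn_const, fun _ _ => zero_le_one⟩
  isVariance_var := by
    rintro (_ | _)
    exacts [⟨continuousOn_const, fun _ _ => le_rfl⟩, ⟨continuousOn_const, fun _ _ => hκ⟩]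

theorem exists_isEquilibrium_parallelGame {δ κ : ℝ} (hδ : 0 ≤ δ) (hκ : 0 ≤ κ) {γ c : ℝ}
    (b : Bool)
    (hcost : ∀ e, (parallelGame hδ hκ).lat e (if e = b then 1 else 0) +
      γ * (parallelGame hδ hκ).var e (if e = b then 1 else 0) = c) :
    ∃ f, (parallelGame hδ hκ).IsEquilibrium γ f ∧
      ∀ e : Bool, (parallelGame hδ hκ).edgeFlow f e = if e = b then 1 else 0 := by
  obtain ⟨f, h0, hsum, hf⟩ := (parallelGame hδ hκ).isFlow_of_weightedPaths (J := Unit)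
    (fun _ => [b]) (fun _ => ⟨⟨rfl, rfl⟩, by simp [parallelGame]⟩) (fun _ => 1)
    fun _ => zero_le_one
  have hf' (e : Bool) : (parallelGame hδ hκ).edgeFlow f e = if e = b then 1 else 0 := by
    refine (hf e).trans ?_
    simp only [Finset.univ_unique, Finset.sum_singleton, List.mem_singleton]
  refine ⟨f, Game.isEquilibrium_of_potential ⟨h0, hsum.trans (by simp)⟩ ![0, c]
    fun e => ?_, hf'⟩
  rw [Game.edgeCost, hf']
  exact (hcost e).trans (sub_zero c).symm

/-! ### Tightness -/

/-- For every `k` some instance attains the ratio `1 + 2 ^ k γ κ`: two parallel edges for `k = 0`,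
and the recursive construction for `k ≥ 1`. -/
theorem exists_instance_attaining {γ κ : ℝ} (hγ : 0 ≤ γ) (hκ : 0 ≤ κ) (k : ℕ) :
    ∃ (I : Game) (x z : I.Path → ℝ), I.IsEquilibrium γ x ∧ I.IsEquilibrium 0 z ∧
      I.VarianceBounded κ x ∧ I.socialCost x = 1 + 2 ^ k * γ * κ ∧ I.socialCost z = 1 ∧
      Fintype.card I.V = 2 ^ (k + 1) ∧
      ∃ π, I.IsAlternatingPath x z π ∧ numForwardSubpaths π = 2 ^ k := by
  rcases k.eq_zero_or_pos with rfl | hk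
  · have hδ : 0 ≤ γ * κ := mul_nonneg hγ hκ
    obtain ⟨x, hx, hxe⟩ := exists_isEquilibrium_parallelGame hδ hκ (γ := γ) (c := 1 + γ * κ) false
      (by rintro (_ | _) <;> simp [parallelGame])
    obtain ⟨z, hz, hze⟩ := exists_isEquilibrium_parallelGame hδ hκ (γ := 0) (c := 1) true
      (by rintro (_ | _) <;> simp [parallelGame])
    have hsum (f : (parallelGame hδ hκ).Path → ℝ) : (parallelGame hδ hκ).socialCost f =
        (parallelGame hδ hκ).edgeFlow f true * 1 +
          (parallelGame hδ hκ).edgeFlow f false *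
            (1 + γ * κ * (parallelGame hδ hκ).edgeFlow f false) :=
      (Game.socialCost_eq_sum f).trans (Fintype.sum_bool _)
    refine ⟨parallelGame hδ hκ, x, z, hx, hz, ?_, ?_, ?_, rfl, [(true, true)], ?_, rfl⟩
    · intro e
      change Bool at e
      rw [hxe]
      cases e
      · simp only [Bool.false_eq_true, if_false, if_true]
        positivity
      · simp
    · rw [hsum, hxe, hxe]
      simp
    · rw [hsum, hze, hze]
      simp
    · refine ⟨⟨⟨rfl, rfl⟩, by simp [parallelGame, Game.stepTgt]⟩, fun a ha => ?_⟩
      rw [List.mem_singleton.1 ha]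
      simp [Game.Used, Game.InA, hxe, hze]
  · obtain ⟨a, ha, h⟩ := exists_isTightInstance hγ hκ hk one_pos
    obtain ⟨x, z, hx, hz, -, π, hπ, hnum, -⟩ := h.alternating
    refine ⟨_, x, z, hx, hz, (h.cost_averse x hx).1, (h.cost_averse x hx).2.trans ?_,
      h.cost_neutral z hz, card_recursiveBraess k, π, hπ, hnum⟩
    push_cast
    exact mul_one _

theorem priceOfRiskAversion_le {F : Family} {γ κ U : ℝ} (hU : 0 ≤ U)
    (h : ∀ (I : Game) (x z : I.Path → ℝ), F I x z → I.IsEquilibrium γ x → I.IsEquilibrium 0 z →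
      I.VarianceBounded κ x → I.socialCost x ≤ U * I.socialCost z) :
    priceOfRiskAversion F γ κ ≤ ENNReal.ofReal U := by
  refine sSup_le ?_
  rintro _ ⟨I, x, z, hF, hx, hz, hv, rfl⟩
  -- Also covers `C(z) = 0`, where `C(x) = 0` and the ratio has the value `0`.
  refine ENNReal.div_le_of_le_mul ?_
  rw [← ENNReal.ofReal_mul hU]
  exact ENNReal.ofReal_le_ofReal (h I x z hF hx hz hv)

theorem socialCost_nonneg {I : Game} {f : I.Path → ℝ} (hf : I.IsFeasible f) :
    0 ≤ I.socialCost f := by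
  rw [Game.socialCost_eq_sum]
  exact Finset.sum_nonneg fun e _ => mul_nonneg (Game.edgeFlow_nonneg hf e)
    ((I.isLatency_lat e).nonneg _ (Game.edgeFlow_nonneg hf e))

section Bounds

variable {γ κ : ℝ}

theorem alternatingLB_mem_riskRatios (hγ : 0 ≤ γ) (hκ : 0 ≤ κ) {η : ℕ} (hη : 1 ≤ η) :
    ENNReal.ofReal (alternatingLB γ κ η) ∈ riskRatios (alternatingFamily η) γ κ := by
  obtain ⟨I, x, z, hx, hz, hv, hCx, hCz, -, π, hπ, hnum⟩ :=
    exists_instance_attaining hγ hκ (Nat.log 2 η)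
  refine ⟨I, x, z, ⟨π, hπ, hnum.trans_le (Nat.pow_log_le_self 2 (by omega))⟩, hx, hz, hv, ?_⟩
  rw [hCx, hCz, ENNReal.ofReal_one, div_one, alternatingLB]

theorem priceOfRiskAversion_alternatingFamily_le (hγ : 0 ≤ γ) (hκ : 0 ≤ κ) (η : ℕ) :
    priceOfRiskAversion (alternatingFamily η) γ κ ≤ ENNReal.ofReal (alternatingUB γ κ η) := by
  refine priceOfRiskAversion_le (by unfold alternatingUB; positivity) ?_
  rintro I x z ⟨π, hπ, hnum⟩ hx hz hv
  refine (Game.socialCost_le_of_weakSteps hγ hκ hx hz hv hπ.1.1 fun a => hπ.weakStep).trans ?_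
  have := socialCost_nonneg hz.1
  unfold alternatingUB
  gcongr

theorem alternatingUB_div_alternatingLB_lt (hγ : 0 ≤ γ) (hκ : 0 ≤ κ) (η : ℕ) :
    alternatingUB γ κ η / alternatingLB γ κ η < 2 := by
  have h : (η : ℝ) ≤ 2 * 2 ^ Nat.log 2 η := by
    exact_mod_cast (pow_succ' 2 _ ▸ Nat.lt_pow_succ_log_self one_lt_two η).le
  have h' := mul_le_mul_of_nonneg_right h (mul_nonneg hγ hκ)
  unfold alternatingUB alternatingLB
  rw [div_lt_iff₀ (by positivity)]
  linarith

theorem alternatingLB_eq_alternatingUB (k : ℕ) :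
    alternatingLB γ κ (2 ^ k) = alternatingUB γ κ (2 ^ k) := by
  simp [alternatingLB, alternatingUB, Nat.log_pow]

/-- With `k + 1 = log₂ n`, the instance with `2 ^ (k + 1) ≤ n` vertices attains `1 + 2 ^ k γ κ`. -/
theorem vertexLB_mem_riskRatios (hγ : 0 ≤ γ) (hκ : 0 ≤ κ) {n : ℕ} (hn : 2 ≤ n) :
    ENNReal.ofReal (vertexLB γ κ n) ∈ riskRatios (vertexFamily n) γ κ := by
  obtain ⟨k, hk⟩ := Nat.exists_eq_add_of_le' (Nat.log_pos one_lt_two hn)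
  obtain ⟨I, x, z, hx, hz, hv, hCx, hCz, hcard, -⟩ := exists_instance_attaining hγ hκ k
  refine ⟨I, x, z, ?_, hx, hz, hv, ?_⟩
  · exact hcard.trans_le (hk ▸ Nat.pow_log_le_self 2 (by omega))
  · rw [hCx, hCz, ENNReal.ofReal_one, div_one, vertexLB, hk]
    congr 1
    ring

theorem priceOfRiskAversion_vertexFamily_le (hγ : 0 ≤ γ) (hκ : 0 ≤ κ) {n : ℕ} (hn : 1 ≤ n) :
    priceOfRiskAversion (vertexFamily n) γ κ ≤ ENNReal.ofReal (vertexUB γ κ n) := by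
  have hn' : (1 : ℝ) ≤ n := by exact_mod_cast hn
  have hceil : (0 : ℝ) ≤ (⌈((n : ℝ) - 1) / 2⌉ : ℝ) := by
    exact Int.cast_nonneg (Int.ceil_nonneg (by linarith))
  refine priceOfRiskAversion_le (by unfold vertexUB; positivity) ?_
  intro I x z hcard hx hz hv
  obtain ⟨π, hπ, hstep⟩ := Game.exists_weak_alternating_path hx.1 hz.1
  refine (Game.socialCost_le_of_weakSteps hγ hκ hx hz hv hπ.1 hstep).trans
    (mul_le_mul_of_nonneg_right ?_ (socialCost_nonneg hz.1))
  have h1 : 2 * numForwardSubpaths π ≤ n := (two_mul_numForwardSubpaths_le_card hπ).trans hcard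
  have h2 : (2 * numForwardSubpaths π : ℝ) ≤ n := by exact_mod_cast h1
  have h3 : (numForwardSubpaths π : ℤ) ≤ ⌈((n : ℝ) - 1) / 2⌉ := by
    rw [← Int.sub_one_lt_iff, Int.lt_ceil]
    push_cast
    linarith
  have h4 : (numForwardSubpaths π : ℝ) ≤ (⌈((n : ℝ) - 1) / 2⌉ : ℝ) := by exact_mod_cast h3
  have h5 := mul_le_mul_of_nonneg_right h4 (mul_nonneg hγ hκ)
  unfold vertexUB
  linarith

theorem vertexUB_div_vertexLB_lt (hγ : 0 ≤ γ) (hκ : 0 ≤ κ) (n : ℕ) :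
    vertexUB γ κ n / vertexLB γ κ n < 2 := by
  have h : n + 1 ≤ 2 * 2 ^ Nat.log 2 n :=
    pow_succ' 2 _ ▸ Nat.lt_pow_succ_log_self one_lt_two n
  have h1 : (n : ℝ) + 1 ≤ 2 * 2 ^ Nat.log 2 n := by exact_mod_cast h
  have h2 : ⌈((n : ℝ) - 1) / 2⌉ ≤ (2 : ℤ) ^ Nat.log 2 n := by
    rw [Int.ceil_le]
    push_cast
    linarith
  have h3 : (⌈((n : ℝ) - 1) / 2⌉ : ℝ) ≤ 2 ^ Nat.log 2 n := by exact_mod_cast h2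
  have h4 := mul_le_mul_of_nonneg_left h3 (mul_nonneg hγ hκ)
  unfold vertexUB vertexLB
  rw [div_lt_iff₀ (by positivity)]
  linarith

theorem vertexLB_eq_vertexUB (k : ℕ) :
    vertexLB γ κ (2 ^ (k + 1)) = vertexUB γ κ (2 ^ (k + 1)) := by
  have h : ⌈(((2 ^ (k + 1) : ℕ) : ℝ) - 1) / 2⌉ = (2 : ℤ) ^ k := by
    rw [Int.ceil_eq_iff]
    push_cast
    rw [pow_succ]
    constructor <;> linarith
  rw [vertexLB, vertexUB, h, Nat.log_pow one_lt_two]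
  push_cast
  ring

end Bounds

end RiskRouting

theorem mainTheorem1 (γ κ : ℝ) (hγ : 0 ≤ γ) (hκ : 0 ≤ κ) :
    -- the construction: `2 ^ (i + 1)` vertices, ratio `1 + 2 ^ i γ κ`, `2 ^ i` forward subpaths
    (∀ (i : ℕ), 1 ≤ i → ∀ (d : ℝ) (hd : 0 < d),
      Fintype.card (RiskRouting.recursiveBraess i).V = 2 ^ (i + 1) ∧
      ∃ (a : ℕ → ℝ → ℝ) (ha : ∀ j, RiskRouting.IsLatency (a j)),
        RiskRouting.IsTightInstance γ κ (2 ^ i) (RiskRouting.recursiveGame i hd hκ a ha)) ∧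
    -- tightness up to a factor less than two, and exact tightness at powers of two, for the
    -- bound in terms of the number of forward subpaths
    (∀ η : ℕ, 1 ≤ η →
      ENNReal.ofReal (RiskRouting.alternatingLB γ κ η) ∈
        RiskRouting.riskRatios (RiskRouting.alternatingFamily η) γ κ ∧
      RiskRouting.priceOfRiskAversion (RiskRouting.alternatingFamily η) γ κ ≤
        ENNReal.ofReal (RiskRouting.alternatingUB γ κ η) ∧
      RiskRouting.alternatingUB γ κ η / RiskRouting.alternatingLB γ κ η < 2 ∧
      ((∃ k : ℕ, η = 2 ^ k) →
        RiskRouting.alternatingLB γ κ η = RiskRouting.alternatingUB γ κ η ∧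
        RiskRouting.priceOfRiskAversion (RiskRouting.alternatingFamily η) γ κ =
          ENNReal.ofReal (RiskRouting.alternatingUB γ κ η))) ∧
    -- the same for the bound in terms of the number of vertices
    (∀ n : ℕ, 2 ≤ n →
      ENNReal.ofReal (RiskRouting.vertexLB γ κ n) ∈
        RiskRouting.riskRatios (RiskRouting.vertexFamily n) γ κ ∧
      RiskRouting.priceOfRiskAversion (RiskRouting.vertexFamily n) γ κ ≤
        ENNReal.ofReal (RiskRouting.vertexUB γ κ n) ∧
      RiskRouting.vertexUB γ κ n / RiskRouting.vertexLB γ κ n < 2 ∧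
      ((∃ k : ℕ, n = 2 ^ k) →
        RiskRouting.vertexLB γ κ n = RiskRouting.vertexUB γ κ n ∧
        RiskRouting.priceOfRiskAversion (RiskRouting.vertexFamily n) γ κ =
          ENNReal.ofReal (RiskRouting.vertexUB γ κ n))) := by
  refine ⟨fun i hi d hd => ⟨RiskRouting.card_recursiveBraess i,
      RiskRouting.exists_isTightInstance hγ hκ hi hd⟩,
    fun η hη => ⟨RiskRouting.alternatingLB_mem_riskRatios hγ hκ hη,
      RiskRouting.priceOfRiskAversion_alternatingFamily_le hγ hκ η,
      RiskRouting.alternatingUB_div_alternatingLB_lt hγ hκ η, ?_⟩,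
    fun n hn => ⟨RiskRouting.vertexLB_mem_riskRatios hγ hκ hn,
      RiskRouting.priceOfRiskAversion_vertexFamily_le hγ hκ (by omega),
      RiskRouting.vertexUB_div_vertexLB_lt hγ hκ n, ?_⟩⟩
  · rintro ⟨k, rfl⟩
    have h := RiskRouting.alternatingLB_eq_alternatingUB (γ := γ) (κ := κ) k
    exact ⟨h, (RiskRouting.priceOfRiskAversion_alternatingFamily_le hγ hκ _).antisymm
      (h ▸ le_sSup (RiskRouting.alternatingLB_mem_riskRatios hγ hκ hη))⟩
  · rintro ⟨k, rfl⟩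
    obtain ⟨k, rfl⟩ : ∃ l, k = l + 1 := Nat.exists_eq_succ_of_ne_zero fun h => by simp [h] at hn
    have h := RiskRouting.vertexLB_eq_vertexUB (γ := γ) (κ := κ) k
    exact ⟨h, (RiskRouting.priceOfRiskAversion_vertexFamily_le hγ hκ (by omega)).antisymm
      (h ▸ le_sSup (RiskRouting.vertexLB_mem_riskRatios hγ hκ hn))⟩
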